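/- There is an absolute constant $C>0$ with the following property. Fix $\eta\in(0,1)$. For every sample size $n$ let $p=p_n\ge 1$ and $K=K_n\ge 2$ be integers, where $p\ge 2$ or $\eta\le 1/2$, and let $(c_i,\boldsymbol x_i)$, $i=1,\dots,n$, be independent pairs of a class label $c_i\in\{1,\dots,K\}$ and a feature vector $\boldsymbol x_i\in\mathbb R^p$ such that (1) (class probabilities) $\Pr(c_i=k)=\pi_k\ge\pi_{\min}>0$ for $k=1,\dots,K$, where $\pi_{\min}$ either does not depend on $n$ or, more generally, may depend on $n$ with $\log K=o(n\pi_{\min})$; (2) (normality) $\boldsymbol x_i\mid c_i=k\sim\mathcal N(\boldsymbol\mu_k,\boldsymbol\Sigma_W)$ for all $k$, with $\boldsymbol\Sigma_W$ positive semidefinite and $\sum_{k=1}^K\pi_k\boldsymbol\mu_k=0$, and the marginal covariance matrix $\boldsymbol\Sigma_T=\mathrm{cov}(\boldsymbol x_i)$ is invertible; (3) (sample size) $\log p=o(n)$ as $n\to\infty$. Here $K$, $p$, $\pi_k$, $\boldsymbol\mu_k$ and $\boldsymbol\Sigma_W$ may depend on $n$. Let $\boldsymbol X\in\mathbb R^{n\times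 p}$ have rows $\boldsymbol x_i^\top$, let $\boldsymbol Z\in\{0,1\}^{n\times K}$ be the class indicator matrix, $n_k=\#\{i:c_i=k\}$, and let $\widetilde{\boldsymbol\Theta}\in\mathbb R^{K\times(K-1)}$ be the score matrix whose $l$-th column has its first $l$ entries equal to $\sqrt{n\,n_{l+1}/(\sum_{i\le l}n_i\sum_{i\le l+1}n_i)}$, its $(l+1)$-st entry equal to $-\sqrt{n\sum_{i\le l}n_i/(n_{l+1}\sum_{i\le l+1}n_i)}$, and its other entries zero. Put $\boldsymbol Y=\boldsymbol Z\widetilde{\boldsymbol\Theta}$, $\boldsymbol B^*=\boldsymbol\Sigma_T^{-1}\boldsymbol\Delta$ and $\boldsymbol E=\boldsymbol Y-\boldsymbol X\boldsymbol B^*$, where $\boldsymbol\Delta\in\mathbb R^{p\times(K-1)}$ has columns $$\boldsymbol\Delta_r=\frac{\sqrt{\pi_{r+1}}\sum_{k=1}^r\pi_k(\boldsymbol\mu_k-\boldsymbol\mu_{r+1})}{\sqrt{\sum_{k=1}^r\pi_k\sum_{k=1}^{r+1}\pi_k}}.$$ Let $\tau=\max_j\sqrt{\sigma_j^2+\max_k\mu_{kj}^2}$,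 where $\sigma_j^2$ are the diagonal entries of $\boldsymbol\Sigma_W$, let $\|\boldsymbol A\|_{\infty,2}$ denote the largest Euclidean norm of a row of $\boldsymbol A$, and let $$\lambda_0=C\tau\sqrt{\frac{(K-1)\log(p\eta^{-1})}{n}}.$$ Then for all sufficiently large $n$, with probability at least $1-\eta$, every class is represented in the sample (so that $\boldsymbol Y$ is well defined) and $$\frac1n\|\boldsymbol X^\top\boldsymbol E\|_{\infty,2}\le\lambda_0 .$$ The constant $C$ does not depend on $\eta$, $p$, $K$, $n$, $\boldsymbol\Sigma_W$, $\boldsymbol\mu_k$ or $\pi_k$. -/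

import Mathlib

open MeasureTheory ProbabilityTheory Filter Asymptotics

namespace OptimalScoring

/-- Parameters of a homoscedastic Gaussian class-conditional model with `K` classes and
`p` features: class probabilities `π_k`, class means `μ_k`, within-class covariance `Σ_W`. -/
structure Model (p K : ℕ) where
  prior : Fin K → ℝ
  mean : Fin K → EuclideanSpace ℝ (Fin p)
  covW : Matrix (Fin p) (Fin p) ℝ

/-- `τ = max_j √(σ_j² + max_k μ_{kj}²)`, with `σ_j²` the diagonal entries of `Σ_W`. -/
noncomputable def Model.tau {p K : ℕ} (M : Model p K) : ℝ :=
  ⨆ j : Fin p, √(M.covW j j + ⨆ k : Fin K, (M.mean k j) ^ 2)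

/-- `w_1 + ⋯ + w_m` (classes are indexed from zero in `Fin K`). -/
def partialSum {K : ℕ} (w : Fin K → ℝ) (m : ℕ) : ℝ :=
  ∑ k : Fin K with k.val < m, w k

/-- The class that is called `l + 1` when classes and columns are numbered from one. -/
def nextClass {K : ℕ} (l : Fin (K - 1)) : Fin K :=
  ⟨l.val + 1, by omega⟩

/-- The `p × (K-1)` matrix `Δ` of orthogonal mean contrasts; its `r`-th column is
`√π_{r+1} ∑_{k ≤ r} π_k (μ_k - μ_{r+1}) / √(∑_{k ≤ r} π_k ∑_{k ≤ r+1} π_k)`. -/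
noncomputable def Model.contrast {p K : ℕ} (M : Model p K) :
    Matrix (Fin p) (Fin (K - 1)) ℝ :=
  Matrix.of fun j r =>
    √(M.prior (nextClass r)) *
      (∑ k : Fin K with k.val < r.val + 1, M.prior k * (M.mean k j - M.mean (nextClass r) j)) /
      √(partialSum M.prior (r.val + 1) * partialSum M.prior (r.val + 2))

/-- The number `n_k` of observations in class `k`. -/
def classCount {n K : ℕ} (c : Fin n → Fin K) (k : Fin K) : ℕ :=
  Fintype.card {i : Fin n // c i = k}

/-- The `n × K` class indicator matrix `Z`. -/
def indicatorMatrix {n K : ℕ} (c : Fin n → Fin K) : Matrix (Fin n) (Fin K) ℝ :=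
  Matrix.of fun i k => if c i = k then 1 else 0

/-- The `K × (K-1)` score matrix: the `l`-th column has `l` entries
`√(n n_{l+1} / (∑_{i ≤ l} n_i ∑_{i ≤ l+1} n_i))`, then the entry
`-√(n ∑_{i ≤ l} n_i / (n_{l+1} ∑_{i ≤ l+1} n_i))`, then zeros. -/
noncomputable def scoreMatrix {n K : ℕ} (c : Fin n → Fin K) :
    Matrix (Fin K) (Fin (K - 1)) ℝ :=
  Matrix.of fun k l =>
    let N : Fin K → ℝ := fun k => (classCount c k : ℝ)
    if k.val < l.val + 1 then
      √(n * N (nextClass l) / (partialSum N (l.val + 1) * partialSum N (l.val + 2)))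
    else if k = nextClass l then
      -√(n * partialSum N (l.val + 1) / (N (nextClass l) * partialSum N (l.val + 2)))
    else 0

/-- The response matrix `Y = Z Θ` of optimal scoring. -/
noncomputable def response {n K : ℕ} (c : Fin n → Fin K) : Matrix (Fin n) (Fin (K - 1)) ℝ :=
  indicatorMatrix c * scoreMatrix c

/-- The `n × p` data matrix `X`, with the observations as rows. -/
def dataMatrix {n p : ℕ} (x : Fin n → EuclideanSpace ℝ (Fin p)) : Matrix (Fin n) (Fin p) ℝ :=
  Matrix.of fun i j => x i j

/-- The population coefficients `B* = Σ_T⁻¹ Δ`. -/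
noncomputable def Model.coef {p K : ℕ} (M : Model p K) (covT : Matrix (Fin p) (Fin p) ℝ) :
    Matrix (Fin p) (Fin (K - 1)) ℝ :=
  covT⁻¹ * M.contrast

/-- The residual matrix `E = Y - X B*`. -/
noncomputable def residual {n p K : ℕ} (M : Model p K) (covT : Matrix (Fin p) (Fin p) ℝ)
    (c : Fin n → Fin K) (x : Fin n → EuclideanSpace ℝ (Fin p)) :
    Matrix (Fin n) (Fin (K - 1)) ℝ :=
  response c - dataMatrix x * M.coef covT

/-- `‖A‖_{∞,2}`, the largest Euclidean norm of a row. -/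
noncomputable def normInfTwo {a b : ℕ} (A : Matrix (Fin a) (Fin b) ℝ) : ℝ :=
  ⨆ i : Fin a, √(∑ j : Fin b, A i j ^ 2)

/-- The covariance matrix of a random vector. -/
noncomputable def covMat {Ω : Type*} [MeasurableSpace Ω] {p : ℕ} (P : Measure Ω)
    (x : Ω → EuclideanSpace ℝ (Fin p)) : Matrix (Fin p) (Fin p) ℝ :=
  Matrix.of fun a b => cov[fun ω => x ω a, fun ω => x ω b; P]

/-- `(c_i, x_i)`, `i = 1, …, n`, are independent, each label is `k` with probability `π_k`,
and `x_i` given `c_i = k` has the law `N(μ_k, Σ_W)`. -/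
structure IsSample {Ω : Type*} [MeasurableSpace Ω] {n p K : ℕ} (P : Measure Ω) (M : Model p K)
    (c : Fin n → Ω → Fin K) (x : Fin n → Ω → EuclideanSpace ℝ (Fin p)) : Prop where
  measurable_label : ∀ i, Measurable (c i)
  measurable_feature : ∀ i, Measurable (x i)
  indep : iIndepFun (fun i ω => (c i ω, x i ω)) P
  label_prob : ∀ i k, P.real {ω | c i ω = k} = M.prior k
  feature_law : ∀ i k,
    (ProbabilityTheory.cond P {ω | c i ω = k}).map (x i) = multivariateGaussian (M.mean k) M.covW

end OptimalScoring

/-!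
Write `x_i = μ_{c_i} + w_i`. Since `Σ_T = Σ_W + ∑ π_k μ_k μ_kᵀ` and `Σ_T B* = Δ`, every entry of
`Xᵀ E / n` splits exactly (`transpose_mul_residual_apply`) into a part that depends on the labels
only, and vanishes when the class frequencies equal the class probabilities, and a noise part that
is centred given the labels.

*Score matrix.* The score matrix is the weighted Helmert matrix of the class frequencies
(`scoreMatrix_eq_helmert`), whose columns are orthonormal for the weighted inner product, and `Δ` is
built in the same way from the class probabilities (`Model.contrast_apply`). By orthonormality, the
class means of the fitted values `X B*` form a contraction, and the within-class variance of each
fitted value is at most one (`Model.fitted_variance_le`).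

*Labels.* The contractions bound the label part of a row, simultaneously for all features, by `τ`
times the chi-square distance between frequencies and probabilities; replacing the population scores
by the sample scores costs the analogous distance for partial sums (`abs_sum_helmert_sub_le`). Both
distances are `O(√(K log(1/η) / n))` as soon as `log(1/η) ≲ n π_min`
(`IsSample.measure_compl_goodLabels_le`). No union bound over features is needed here, which matters
because `log p` may exceed `n π_min`.

*Noise.* Given the labels, the noise is a sum of independent linear and centred quadratic Gaussian
forms, so its entries have sub-Gaussian exponential moments at the scale `√(n log(p/η)) / τ`
(`lintegral_exp_observation_le`, `IsSample.setLIntegral_exp_noise_le`).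

*From entries to rows.* A union bound over the `K - 1` columns would cost a factor `log K`. Instead,
`y ↦ cosh (s √y)` is convex, so `cosh (s · rms v)` is at most the mean of the `cosh (s v_r)`, and the
root mean square of a row has the same exponential tail as a single entry
(`measure_inter_rms_ge_le`). A union bound over the `p` rows then gives `log (p/η)`.
-/

/-! ### Tail bounds for the Euclidean norm of a random vector -/

/-- Jensen's inequality for the convex function `y ↦ cosh (s √y)`: if `θ` is at most the root mean
square of `v`, then `cosh (s θ)` is at most the mean of the `cosh (s vᵣ)`. -/
lemma cosh_mul_le_mean_cosh {ι : Type*} [Fintype ι] [Nonempty ι] {v : ι → ℝ} {s θ : ℝ}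
    (h : Fintype.card ι * θ ^ 2 ≤ ∑ r, v r ^ 2) :
    Real.cosh (s * θ) ≤ (Fintype.card ι : ℝ)⁻¹ * ∑ r, Real.cosh (s * v r) := by
  have hc : (0 : ℝ) < Fintype.card ι := by exact_mod_cast Fintype.card_pos
  have h1 := Real.hasSum_cosh (s * θ)
  have h2 : HasSum (fun n : ℕ => (Fintype.card ι : ℝ)⁻¹ *
      ∑ r, (s * v r) ^ (2 * n) / ((2 * n).factorial : ℝ))
      ((Fintype.card ι : ℝ)⁻¹ * ∑ r, Real.cosh (s * v r)) :=
    (hasSum_sum fun r _ => Real.hasSum_cosh (s * v r)).mul_left _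
  refine hasSum_le (fun n => ?_) h1 h2
  rw [← Finset.sum_div, ← mul_div_assoc]
  refine div_le_div_of_nonneg_right ?_ (Nat.cast_nonneg _)
  have hs : θ ^ 2 ≤ ∑ r, (Fintype.card ι : ℝ)⁻¹ * v r ^ 2 := by
    rw [← Finset.mul_sum, le_inv_mul_iff₀ hc]; exact h
  calc (s * θ) ^ (2 * n) = (s ^ 2) ^ n * (θ ^ 2) ^ n := by rw [pow_mul, mul_pow, mul_pow]
    _ ≤ (s ^ 2) ^ n * (∑ r, (Fintype.card ι : ℝ)⁻¹ * v r ^ 2) ^ n := by gcongr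
    _ ≤ (s ^ 2) ^ n * ∑ r, (Fintype.card ι : ℝ)⁻¹ * (v r ^ 2) ^ n := by
        gcongr
        refine Real.pow_arith_mean_le_arith_mean_pow _ _ _ (fun _ _ => by positivity) ?_
          (fun _ _ => by positivity) n
        simp [hc.ne']
    _ = _ := by
        rw [Finset.mul_sum, Finset.mul_sum]
        refine Finset.sum_congr rfl fun r _ => ?_
        rw [pow_mul, mul_pow, mul_pow]; ring

/-- If each coordinate of a random vector has exponential moment at most `L` at `± s` on `H`, then
on `H` its root mean square exceeds `θ` with probability at most `2 L e^{-sθ}`. The bound does not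
depend on the number of coordinates. -/
lemma measure_inter_rms_ge_le {Ω : Type*} [MeasurableSpace Ω] {P : Measure Ω} {ι : Type*}
    [Fintype ι] [Nonempty ι] {v : ι → Ω → ℝ} (hv : ∀ r, Measurable (v r)) {H : Set Ω}
    (hH : MeasurableSet H) {s θ : ℝ} {L : ENNReal}
    (hpos : ∀ r, ∫⁻ ω in H, ENNReal.ofReal (Real.exp (s * v r ω)) ∂P ≤ L)
    (hneg : ∀ r, ∫⁻ ω in H, ENNReal.ofReal (Real.exp (-s * v r ω)) ∂P ≤ L) :
    P (H ∩ {ω | Fintype.card ι * θ ^ 2 ≤ ∑ r, v r ω ^ 2}) ≤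
      ENNReal.ofReal (2 * Real.exp (-(s * θ))) * L := by
  have hc : (0 : ℝ) < Fintype.card ι := by exact_mod_cast Fintype.card_pos
  set k : ℝ := Real.exp (-(s * θ)) * (Fintype.card ι : ℝ)⁻¹ with hk
  have hk0 : 0 ≤ k := by positivity
  set g : Ω → ENNReal := fun ω => ENNReal.ofReal k *
    ∑ r, (ENNReal.ofReal (Real.exp (s * v r ω)) + ENNReal.ofReal (Real.exp (-s * v r ω)))
  have hg : Measurable g := by fun_prop
  have hsub : {ω | Fintype.card ι * θ ^ 2 ≤ ∑ r, v r ω ^ 2} ⊆ {ω | 1 ≤ g ω} := by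
    intro ω hω
    have h := cosh_mul_le_mean_cosh (s := s) hω
    have h2 : Real.exp (s * θ) ≤ 2 * Real.cosh (s * θ) := by
      rw [Real.cosh_eq]; have := Real.exp_pos (-(s * θ)); linarith
    have h3 : 1 ≤ k * ∑ r, (Real.exp (s * v r ω) + Real.exp (-s * v r ω)) := by
      have h4 : ∑ r, (Real.exp (s * v r ω) + Real.exp (-s * v r ω))
          = 2 * ∑ r, Real.cosh (s * v r ω) := by
        rw [Finset.mul_sum]
        refine Finset.sum_congr rfl fun r _ => ?_
        rw [Real.cosh_eq, neg_mul]; ring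
      have h5 : 1 = Real.exp (-(s * θ)) * Real.exp (s * θ) := by rw [← Real.exp_add]; simp
      rw [h4, hk, h5]
      have := Real.exp_pos (-(s * θ))
      nlinarith
    show 1 ≤ ENNReal.ofReal k *
      ∑ r, (ENNReal.ofReal (Real.exp (s * v r ω)) + ENNReal.ofReal (Real.exp (-s * v r ω)))
    have h6 : ∀ r, ENNReal.ofReal (Real.exp (s * v r ω)) + ENNReal.ofReal (Real.exp (-s * v r ω))
        = ENNReal.ofReal (Real.exp (s * v r ω) + Real.exp (-s * v r ω)) := fun r =>
      (ENNReal.ofReal_add (Real.exp_nonneg _) (Real.exp_nonneg _)).symm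
    simp_rw [h6]
    rw [← ENNReal.ofReal_sum_of_nonneg (fun _ _ => by positivity), ← ENNReal.ofReal_mul hk0]
    exact ENNReal.one_le_ofReal.2 h3
  calc P (H ∩ {ω | Fintype.card ι * θ ^ 2 ≤ ∑ r, v r ω ^ 2})
      ≤ P (H ∩ {ω | 1 ≤ g ω}) := measure_mono (Set.inter_subset_inter_right _ hsub)
    _ = 1 * (P.restrict H) {ω | 1 ≤ g ω} := by
        rw [Measure.restrict_apply' hH, Set.inter_comm, one_mul]
    _ ≤ ∫⁻ ω in H, g ω ∂P := mul_meas_ge_le_lintegral₀ hg.aemeasurable 1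
    _ = ENNReal.ofReal k * ∑ r, (∫⁻ ω in H, ENNReal.ofReal (Real.exp (s * v r ω)) ∂P +
          ∫⁻ ω in H, ENNReal.ofReal (Real.exp (-s * v r ω)) ∂P) := by
        rw [lintegral_const_mul _ (by fun_prop), lintegral_finsetSum _ (fun _ _ => by fun_prop)]
        congr 1
        refine Finset.sum_congr rfl fun r _ => ?_
        rw [lintegral_add_left (by fun_prop)]
    _ ≤ ENNReal.ofReal k * ∑ _r : ι, (L + L) := by
        gcongr with r
        · exact hpos r
        · exact hneg r
    _ = _ := by
        rw [Finset.sum_const, Finset.card_univ, nsmul_eq_mul, ← two_mul, hk,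
          ENNReal.ofReal_mul (Real.exp_nonneg _), ENNReal.ofReal_mul (by norm_num),
          ENNReal.ofReal_inv_of_pos hc, ENNReal.ofReal_natCast, ENNReal.ofReal_ofNat]
        have h0 : (Fintype.card ι : ENNReal) ≠ 0 := by simp
        have h1 : (Fintype.card ι : ENNReal) ≠ ⊤ := by simp
        calc _ = ((Fintype.card ι : ENNReal)⁻¹ * (Fintype.card ι : ENNReal)) *
              (2 * ENNReal.ofReal (Real.exp (-(s * θ))) * L) := by ring
          _ = _ := by rw [ENNReal.inv_mul_cancel h0 h1, one_mul]

/-! ### Exponential moments of Gaussian variables -/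

lemma lintegral_exp_gaussianReal (v : NNReal) (u : ℝ) :
    ∫⁻ x, ENNReal.ofReal (Real.exp (u * x)) ∂gaussianReal 0 v
      = ENNReal.ofReal (Real.exp (v * u ^ 2 / 2)) := by
  rw [← ofReal_integral_eq_lintegral_ofReal (integrable_exp_mul_gaussianReal u)
    (ae_of_all _ fun x => (Real.exp_nonneg _))]
  have := congrFun (mgf_fun_id_gaussianReal (μ := 0) (v := v)) u
  simp only [mgf, zero_mul, zero_add] at this
  rw [this]

/-- A centred squared Gaussian variable is sub-exponential. -/
lemma lintegral_exp_sq_sub_gaussianReal_le (v : NNReal) (u : ℝ) (h : |u| * v ≤ 1 / 4) :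
    ∫⁻ x, ENNReal.ofReal (Real.exp (u * (x ^ 2 - v))) ∂gaussianReal 0 v
      ≤ ENNReal.ofReal (Real.exp (4 * (u * v) ^ 2)) := by
  rcases eq_or_ne v 0 with rfl | hv
  · simp [gaussianReal_zero_var]
  have hv0 : (0 : ℝ) < v := by positivity
  have huv : |u * v| ≤ 1 / 4 := by rwa [abs_mul, abs_of_pos hv0]
  obtain ⟨h1, h2⟩ := abs_le.1 huv
  set b : ℝ := 1 / (2 * v) - u with hb
  have hb' : b = (1 - 2 * (u * v)) / (2 * v) := by rw [hb]; field_simp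
  have hb0 : 0 < b := by rw [hb']; apply div_pos <;> linarith
  rw [gaussianReal_of_var_ne_zero _ hv,
    lintegral_withDensity_eq_lintegral_mul _ (measurable_gaussianPDF _ _) (by fun_prop)]
  set c : ℝ := (√(2 * Real.pi * v))⁻¹ * Real.exp (-(u * v)) with hcdef
  have hc0 : 0 ≤ c := by positivity
  have hpt : ∀ x : ℝ, (gaussianPDF 0 v * fun x => ENNReal.ofReal (Real.exp (u * (x ^ 2 - v)))) x
      = ENNReal.ofReal c * ENNReal.ofReal (Real.exp (-b * x ^ 2)) := by
    intro x
    simp only [Pi.mul_apply, gaussianPDF, gaussianPDFReal_def]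
    rw [← ENNReal.ofReal_mul (by positivity), ← ENNReal.ofReal_mul hc0]
    congr 1
    rw [hcdef, mul_assoc, mul_assoc _ (Real.exp (-(u * v))), ← Real.exp_add, ← Real.exp_add]
    congr 2
    rw [hb]; field_simp; ring
  simp_rw [hpt]
  rw [lintegral_const_mul _ (by fun_prop), ← ofReal_integral_eq_lintegral_ofReal
    (integrable_exp_neg_mul_sq hb0) (ae_of_all _ fun x => (Real.exp_nonneg _)), integral_gaussian,
    ← ENNReal.ofReal_mul hc0]
  apply ENNReal.ofReal_le_ofReal
  -- the integral equals `exp (-y/2) / √(1 - y)` with `y = 2uv`, and `-log (1 - y) ≤ y + 2y²`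
  have hy : 0 < 1 - 2 * (u * v) := by linarith
  have hlog := Real.abs_log_sub_add_sum_range_le (x := 2 * (u * v))
    (by rw [abs_mul]; norm_num; linarith) 1
  simp only [Finset.range_one, Finset.sum_singleton, zero_add, pow_one, Nat.cast_zero,
    div_one] at hlog
  have h3 : |2 * (u * v)| ^ (1 + 1) / (1 - |2 * (u * v)|) ≤ 2 * (2 * (u * v)) ^ 2 := by
    have h4 : |2 * (u * v)| ≤ 1 / 2 := by rw [abs_mul]; norm_num; linarith
    rw [div_le_iff₀ (by linarith), one_add_one_eq_two, sq_abs]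
    nlinarith [sq_nonneg (2 * (u * v))]
  have h5 := (abs_le.1 (hlog.trans h3)).1
  have h6 : √(Real.pi / b) = √(2 * Real.pi * v) * Real.exp (-Real.log (1 - 2 * (u * v)) / 2) := by
    have : Real.exp (-Real.log (1 - 2 * (u * v)) / 2) = √((1 - 2 * (u * v))⁻¹) := by
      rw [← Real.log_inv, Real.exp_half, Real.exp_log (by positivity)]
    rw [this, ← Real.sqrt_mul (by positivity), hb']
    congr 1; field_simp
  rw [h6, hcdef]
  have h7 : √(2 * Real.pi * v) ≠ 0 := by positivity
  calc _ = Real.exp (-(u * v)) * Real.exp (-Real.log (1 - 2 * (u * v)) / 2) := by field_simp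
    _ ≤ _ := by
      rw [← Real.exp_add]; apply Real.exp_le_exp.2; nlinarith

/-- By convexity of `exp`, exponential moments of a sum are controlled by those of the scaled
summands, without any independence. -/
lemma lintegral_exp_sum_le {E ι : Type*} [MeasurableSpace E] {ν : Measure E} [Fintype ι]
    [Nonempty ι] {f : ι → E → ℝ} (hf : ∀ i, Measurable (f i)) {L : ENNReal}
    (h : ∀ i, ∫⁻ x, ENNReal.ofReal (Real.exp (Fintype.card ι * f i x)) ∂ν ≤ L) :
    ∫⁻ x, ENNReal.ofReal (Real.exp (∑ i, f i x)) ∂ν ≤ L := by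
  have hc : (0 : ℝ) < Fintype.card ι := by exact_mod_cast Fintype.card_pos
  have hpt : ∀ x, ENNReal.ofReal (Real.exp (∑ i, f i x)) ≤
      ENNReal.ofReal (Fintype.card ι : ℝ)⁻¹ *
        ∑ i, ENNReal.ofReal (Real.exp (Fintype.card ι * f i x)) := by
    intro x
    rw [← ENNReal.ofReal_sum_of_nonneg (fun _ _ => by positivity),
      ← ENNReal.ofReal_mul (by positivity)]
    apply ENNReal.ofReal_le_ofReal
    have := convexOn_exp.map_sum_le (t := Finset.univ) (w := fun _ : ι => (Fintype.card ι : ℝ)⁻¹)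
      (p := fun i => Fintype.card ι * f i x) (fun _ _ => by positivity)
      (by simp [hc.ne']) (fun _ _ => Set.mem_univ _)
    simp only [smul_eq_mul, ← mul_assoc, inv_mul_cancel₀ hc.ne', one_mul] at this
    rwa [← Finset.mul_sum] at this
  calc _ ≤ ∫⁻ x, ENNReal.ofReal (Fintype.card ι : ℝ)⁻¹ *
        ∑ i, ENNReal.ofReal (Real.exp (Fintype.card ι * f i x)) ∂ν := lintegral_mono hpt
    _ ≤ ENNReal.ofReal (Fintype.card ι : ℝ)⁻¹ * ∑ _i : ι, L := by
        rw [lintegral_const_mul _ (by fun_prop), lintegral_finsetSum _ (fun _ _ => by fun_prop)]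
        gcongr with i
        exact h i
    _ = L := by
        rw [Finset.sum_const, Finset.card_univ, nsmul_eq_mul, ENNReal.ofReal_inv_of_pos hc,
          ENNReal.ofReal_natCast, ← mul_assoc, ENNReal.inv_mul_cancel (by simp) (by simp), one_mul]

/-! ### Linear and quadratic forms of a Gaussian vector -/

section

variable {p : ℕ} {S : Matrix (Fin p) (Fin p) ℝ}

open Matrix in
lemma map_linear_multivariateGaussian (hS : S.PosSemidef) (μ : EuclideanSpace ℝ (Fin p))
    (γ : Fin p → ℝ) :
    (multivariateGaussian μ S).map (fun x => ∑ a, γ a * (x a - μ a))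
      = gaussianReal 0 (γ ⬝ᵥ S *ᵥ γ).toNNReal := by
  set L : StrongDual ℝ (EuclideanSpace ℝ (Fin p)) := innerSL ℝ (WithLp.toLp 2 γ) with hL
  have hLx : ∀ x, L x = ∑ a, γ a * x a := by
    intro x; simp [hL, PiLp.inner_apply, mul_comm]
  have hfun : (fun x : EuclideanSpace ℝ (Fin p) => ∑ a, γ a * (x a - μ a))
      = (fun y => y - L μ) ∘ L := by
    ext x
    simp only [Function.comp, hLx, ← Finset.sum_sub_distrib, mul_sub]
  have hvar : Var[L; multivariateGaussian μ S] = γ ⬝ᵥ S *ᵥ γ := by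
    have h1 := covarianceBilin_self (μ := multivariateGaussian μ S) IsGaussian.memLp_two_id
      (WithLp.toLp 2 γ)
    rw [covarianceBilin_multivariateGaussian hS] at h1
    exact h1.symm
  rw [hfun, ← Measure.map_map (by fun_prop) (by fun_prop), IsGaussian.map_eq_gaussianReal,
    gaussianReal_map_sub_const, hvar, L.integral_comp_id_comm IsGaussian.integrable_id,
    integral_id_multivariateGaussian, sub_self]

open Matrix in
lemma lintegral_exp_linear_le (hS : S.PosSemidef) (μ : EuclideanSpace ℝ (Fin p))
    (γ : Fin p → ℝ) {V u : ℝ} (hV : γ ⬝ᵥ S *ᵥ γ ≤ V) :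
    ∫⁻ x, ENNReal.ofReal (Real.exp (u * ∑ a, γ a * (x a - μ a))) ∂multivariateGaussian μ S
      ≤ ENNReal.ofReal (Real.exp (u ^ 2 * V / 2)) := by
  have h0 : 0 ≤ γ ⬝ᵥ S *ᵥ γ := by simpa using hS.dotProduct_mulVec_nonneg γ
  rw [← lintegral_map (f := fun y => ENNReal.ofReal (Real.exp (u * y)))
    (g := fun x : EuclideanSpace ℝ (Fin p) => ∑ a, γ a * (x a - μ a)) (by fun_prop) (by fun_prop),
    map_linear_multivariateGaussian hS, lintegral_exp_gaussianReal, Real.coe_toNNReal _ h0]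
  apply ENNReal.ofReal_le_ofReal
  apply Real.exp_le_exp.2
  nlinarith [sq_nonneg u]

open Matrix in
lemma lintegral_exp_sq_linear_le (hS : S.PosSemidef) (μ : EuclideanSpace ℝ (Fin p))
    (γ : Fin p → ℝ) {V u : ℝ} (hV : γ ⬝ᵥ S *ᵥ γ ≤ V) (hu : |u| * V ≤ 1 / 4) :
    ∫⁻ x, ENNReal.ofReal (Real.exp (u * ((∑ a, γ a * (x a - μ a)) ^ 2 - γ ⬝ᵥ S *ᵥ γ)))
        ∂multivariateGaussian μ S
      ≤ ENNReal.ofReal (Real.exp (4 * (u * V) ^ 2)) := by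
  have h0 : 0 ≤ γ ⬝ᵥ S *ᵥ γ := by simpa using hS.dotProduct_mulVec_nonneg γ
  rw [← lintegral_map
    (f := fun y => ENNReal.ofReal (Real.exp (u * (y ^ 2 - γ ⬝ᵥ S *ᵥ γ))))
    (g := fun x : EuclideanSpace ℝ (Fin p) => ∑ a, γ a * (x a - μ a)) (by fun_prop) (by fun_prop),
    map_linear_multivariateGaussian hS]
  have h1 := lintegral_exp_sq_sub_gaussianReal_le (γ ⬝ᵥ S *ᵥ γ).toNNReal u (by
    rw [Real.coe_toNNReal _ h0]
    exact (mul_le_mul_of_nonneg_left hV (abs_nonneg u)).trans hu)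
  rw [Real.coe_toNNReal _ h0] at h1
  refine h1.trans (ENNReal.ofReal_le_ofReal (Real.exp_le_exp.2 ?_))
  rw [mul_pow, mul_pow]
  gcongr

open Matrix in
/-- Exponential moment of the contribution of one observation to a centred entry of `Xᵀ E`, for a
fixed label: with `w = x - μ`, a linear form in `w` plus the centred product of two linear forms.
The product is polarised into a difference of two centred squares. -/
lemma lintegral_exp_observation_le (hS : S.PosSemidef) (μ : EuclideanSpace ℝ (Fin p))
    (γ β : Fin p → ℝ) {τ u α m : ℝ} (hτ : 0 < τ) (hγ : γ ⬝ᵥ S *ᵥ γ ≤ τ ^ 2)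
    (hβ : β ⬝ᵥ S *ᵥ β ≤ 1) (hm : m ^ 2 ≤ τ ^ 2) (hu : |u| * τ ≤ 1 / 16) :
    ∫⁻ x, ENNReal.ofReal (Real.exp (u * (α * (∑ a, γ a * (x a - μ a))
        - m * (∑ a, β a * (x a - μ a))
        - ((∑ a, γ a * (x a - μ a)) * (∑ a, β a * (x a - μ a)) - γ ⬝ᵥ S *ᵥ β))))
        ∂multivariateGaussian μ S
      ≤ ENNReal.ofReal (Real.exp ((u * τ) ^ 2 * (8 * α ^ 2 + 64))) := by
  set g : EuclideanSpace ℝ (Fin p) → ℝ := fun x => ∑ a, γ a * (x a - μ a) with hg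
  set b : EuclideanSpace ℝ (Fin p) → ℝ := fun x => ∑ a, β a * (x a - μ a) with hb
  set δ : Fin p → ℝ := τ⁻¹ • γ with hδ
  have hsymm : β ⬝ᵥ S *ᵥ γ = γ ⬝ᵥ S *ᵥ β := by
    have hT : Sᵀ = S := by simpa using hS.isHermitian.eq
    rw [dotProduct_mulVec, ← mulVec_transpose, hT, dotProduct_comm]
  have hδδ : δ ⬝ᵥ S *ᵥ δ = (τ⁻¹) ^ 2 * (γ ⬝ᵥ S *ᵥ γ) := by
    simp only [hδ, mulVec_smul, dotProduct_smul, smul_dotProduct, smul_eq_mul]; ring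
  have hδ1 : δ ⬝ᵥ S *ᵥ δ ≤ 1 := by
    rw [hδδ, inv_pow, inv_mul_le_iff₀ (by positivity), mul_one]; exact hγ
  have hadd : (δ + β) ⬝ᵥ S *ᵥ (δ + β)
      = δ ⬝ᵥ S *ᵥ δ + β ⬝ᵥ S *ᵥ β + 2 * τ⁻¹ * (γ ⬝ᵥ S *ᵥ β) := by
    simp only [mulVec_add, dotProduct_add, add_dotProduct, hδ, mulVec_smul, dotProduct_smul,
      smul_dotProduct, smul_eq_mul, hsymm]; ring
  have hsub : (δ - β) ⬝ᵥ S *ᵥ (δ - β)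
      = δ ⬝ᵥ S *ᵥ δ + β ⬝ᵥ S *ᵥ β - 2 * τ⁻¹ * (γ ⬝ᵥ S *ᵥ β) := by
    simp only [mulVec_sub, dotProduct_sub, sub_dotProduct, hδ, mulVec_smul, dotProduct_smul,
      smul_dotProduct, smul_eq_mul, hsymm]; ring
  have hp : 0 ≤ (δ + β) ⬝ᵥ S *ᵥ (δ + β) := by simpa using hS.dotProduct_mulVec_nonneg (δ + β)
  have hn : 0 ≤ (δ - β) ⬝ᵥ S *ᵥ (δ - β) := by simpa using hS.dotProduct_mulVec_nonneg (δ - β)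
  have hp4 : (δ + β) ⬝ᵥ S *ᵥ (δ + β) ≤ 4 := by linarith
  have hn4 : (δ - β) ⬝ᵥ S *ᵥ (δ - β) ≤ 4 := by linarith
  have hga : ∀ x : EuclideanSpace ℝ (Fin p), ∑ a, (δ + β) a * (x a - μ a) = τ⁻¹ * g x + b x := by
    intro x
    simp only [hg, hb, hδ, Finset.mul_sum, ← Finset.sum_add_distrib, Pi.add_apply, Pi.smul_apply,
      smul_eq_mul]
    exact Finset.sum_congr rfl fun a _ => by ring
  have hgs : ∀ x : EuclideanSpace ℝ (Fin p), ∑ a, (δ - β) a * (x a - μ a) = τ⁻¹ * g x - b x := by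
    intro x
    simp only [hg, hb, hδ, Finset.mul_sum, ← Finset.sum_sub_distrib, Pi.sub_apply, Pi.smul_apply,
      smul_eq_mul]
    exact Finset.sum_congr rfl fun a _ => by ring
  have hgm : Measurable g := by fun_prop
  have hbm : Measurable b := by fun_prop
  let f : Fin 4 → EuclideanSpace ℝ (Fin p) → ℝ := ![fun x => u * α * g x, fun x => -(u * m) * b x,
    fun x => -(u * τ / 4) * ((τ⁻¹ * g x + b x) ^ 2 - (δ + β) ⬝ᵥ S *ᵥ (δ + β)),
    fun x => u * τ / 4 * ((τ⁻¹ * g x - b x) ^ 2 - (δ - β) ⬝ᵥ S *ᵥ (δ - β))]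
  have hf : ∀ x, u * (α * g x - m * b x - (g x * b x - γ ⬝ᵥ S *ᵥ β)) = ∑ i, f i x := by
    intro x
    simp only [f, Fin.sum_univ_four, Matrix.cons_val, hadd, hsub]
    field_simp; ring
  have huτ : |u * τ| ≤ 1 / 16 := by rwa [abs_mul, abs_of_pos hτ]
  have key : ∀ {A : ℝ}, A ≤ (u * τ) ^ 2 * (8 * α ^ 2 + 64) → ENNReal.ofReal (Real.exp A) ≤
      ENNReal.ofReal (Real.exp ((u * τ) ^ 2 * (8 * α ^ 2 + 64))) := fun h =>
    ENNReal.ofReal_le_ofReal (Real.exp_le_exp.2 h)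
  have hu2 : 0 ≤ (u * τ) ^ 2 := sq_nonneg _
  calc _ = ∫⁻ x, ENNReal.ofReal (Real.exp (∑ i, f i x)) ∂multivariateGaussian μ S := by
        exact lintegral_congr fun x => by rw [← hf]
    _ ≤ _ := by
      refine lintegral_exp_sum_le ?_ ?_
      · intro i; fin_cases i <;> simp only [f, Fin.reduceFinMk, Matrix.cons_val] <;> fun_prop
      · intro i
        simp only [Fintype.card_fin]
        fin_cases i
        · have := lintegral_exp_linear_le hS μ γ (u := 4 * (u * α)) hγ
          refine le_trans (le_of_eq ?_) (this.trans (key ?_))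
          · refine lintegral_congr fun x => ?_
            simp only [f, hg, Fin.reduceFinMk, Matrix.cons_val]
            congr 2; push_cast; ring
          · nlinarith
        · have := lintegral_exp_linear_le hS μ β (u := 4 * (-(u * m))) hβ
          refine le_trans (le_of_eq ?_) (this.trans (key ?_))
          · refine lintegral_congr fun x => ?_
            simp only [f, hb, Fin.reduceFinMk, Matrix.cons_val]
            congr 2; push_cast; ring
          · have : u ^ 2 * m ^ 2 ≤ u ^ 2 * τ ^ 2 := by gcongr
            nlinarith [mul_nonneg hu2 (sq_nonneg α)]
        · have := lintegral_exp_sq_linear_le hS μ (δ + β) (u := -(u * τ)) hp4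
            (by rw [abs_neg]; linarith)
          refine le_trans (le_of_eq ?_) (this.trans (key ?_))
          · refine lintegral_congr fun x => ?_
            simp only [f, Fin.reduceFinMk, Matrix.cons_val, hga]
            congr 2; push_cast; ring
          · nlinarith [mul_nonneg hu2 (sq_nonneg α)]
        · have := lintegral_exp_sq_linear_le hS μ (δ - β) (u := u * τ) hn4 (by linarith)
          refine le_trans (le_of_eq ?_) (this.trans (key ?_))
          · refine lintegral_congr fun x => ?_
            simp only [f, Fin.reduceFinMk, Matrix.cons_val, hgs]
            congr 2; push_cast; ring
          · nlinarith [mul_nonneg hu2 (sq_nonneg α)]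

end

/-! ### Factorisation of expectations over the sample -/

namespace OptimalScoring

variable {Ω : Type*} [MeasurableSpace Ω] {n p K : ℕ} {P : Measure Ω} {M : Model p K}
  {c : Fin n → Ω → Fin K} {x : Fin n → Ω → EuclideanSpace ℝ (Fin p)}

lemma IsSample.measurableSet_label (h : IsSample P M c x) (i : Fin n) (k : Fin K) :
    MeasurableSet {ω | c i ω = k} :=
  h.measurable_label i (measurableSet_singleton k)

variable [IsProbabilityMeasure P]

lemma IsSample.measure_label (h : IsSample P M c x) (i : Fin n) (k : Fin K) :
    P {ω | c i ω = k} = ENNReal.ofReal (M.prior k) := by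
  rw [← h.label_prob i k, ofReal_measureReal]

lemma IsSample.lintegral_label (h : IsSample P M c x) (i : Fin n) (G : Fin K → ENNReal) :
    ∫⁻ ω, G (c i ω) ∂P = ∑ k, ENNReal.ofReal (M.prior k) * G k := by
  rw [← lintegral_map (f := G) (measurable_of_finite G) (h.measurable_label i), lintegral_fintype]
  refine Finset.sum_congr rfl fun k _ => ?_
  rw [Measure.map_apply (h.measurable_label i) (measurableSet_singleton k), mul_comm,
    ← h.measure_label i k]
  rfl

lemma IsSample.sum_ofReal_prior (h : IsSample P M c x) (i : Fin n) :
    ∑ k, ENNReal.ofReal (M.prior k) = 1 := by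
  simpa using (h.lintegral_label i fun _ => 1).symm

lemma IsSample.sum_prior (h : IsSample P M c x) (i : Fin n) : ∑ k, M.prior k = 1 := by
  have h0 : ∀ k, 0 ≤ M.prior k := fun k => h.label_prob i k ▸ measureReal_nonneg
  have h1 := h.sum_ofReal_prior i
  rw [← ENNReal.ofReal_sum_of_nonneg fun k _ => h0 k] at h1
  simpa using h1

lemma IsSample.setLIntegral_feature (h : IsSample P M c x) (hπ : ∀ k, 0 < M.prior k) (i : Fin n)
    (k : Fin K) {f : EuclideanSpace ℝ (Fin p) → ENNReal} (hf : Measurable f) :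
    ∫⁻ ω in {ω | c i ω = k}, f (x i ω) ∂P
      = ENNReal.ofReal (M.prior k) * ∫⁻ y, f y ∂multivariateGaussian (M.mean k) M.covW := by
  have h0 : P {ω | c i ω = k} ≠ 0 := by
    rw [h.measure_label]; simpa using hπ k
  rw [← h.feature_law i k, lintegral_map hf (h.measurable_feature i), ProbabilityTheory.cond,
    lintegral_smul_measure, smul_eq_mul, ← mul_assoc, ← h.measure_label i k,
    ENNReal.mul_inv_cancel h0 (measure_ne_top _ _), one_mul]

lemma IsSample.setLIntegral_prod (h : IsSample P M c x) (hπ : ∀ k, 0 < M.prior k)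
    (κ : Fin n → Fin K) {g : Fin n → EuclideanSpace ℝ (Fin p) → ENNReal}
    (hg : ∀ i, Measurable (g i)) :
    ∫⁻ ω in {ω | (fun i => c i ω) = κ}, ∏ i, g i (x i ω) ∂P
      = ∏ i, (ENNReal.ofReal (M.prior (κ i)) *
          ∫⁻ y, g i y ∂multivariateGaussian (M.mean (κ i)) M.covW) := by
  set F : ∀ i : Fin n, Fin K × EuclideanSpace ℝ (Fin p) → ENNReal :=
    fun i z => Set.indicator {z | z.1 = κ i} (fun z => g i z.2) z with hF
  have hFm : ∀ i, Measurable (F i) := fun i =>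
    ((hg i).comp measurable_snd).indicator (measurable_fst (measurableSet_singleton (κ i)))
  have hset : MeasurableSet {ω | (fun i => c i ω) = κ} := by
    have : {ω | (fun i => c i ω) = κ} = ⋂ i, {ω | c i ω = κ i} := by
      ext ω; simp [funext_iff]
    rw [this]
    exact MeasurableSet.iInter fun i => h.measurableSet_label i _
  have hind := h.indep.comp F hFm
  have hmeas : ∀ i, Measurable (F i ∘ fun ω => (c i ω, x i ω)) := fun i =>
    (hFm i).comp ((h.measurable_label i).prodMk (h.measurable_feature i))
  have hprod := lintegral_prod_eq_prod_lintegral_of_indepFun Finset.univ _ hind hmeas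
  rw [← lintegral_indicator hset]
  calc _ = ∫⁻ ω, ∏ i, (F i ∘ fun ω => (c i ω, x i ω)) ω ∂P := by
        refine lintegral_congr fun ω => ?_
        by_cases hω : (fun i => c i ω) = κ
        · rw [Set.indicator_of_mem (by exact hω)]
          refine Finset.prod_congr rfl fun i _ => ?_
          simp [hF, congrFun hω i]
        · rw [Set.indicator_of_notMem (by exact hω)]
          obtain ⟨i, hi⟩ := Function.ne_iff.1 hω
          exact (Finset.prod_eq_zero (Finset.mem_univ i) (by simp [hF, hi])).symm
    _ = _ := by
        rw [hprod]
        refine Finset.prod_congr rfl fun i _ => ?_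
        rw [← h.setLIntegral_feature hπ i (κ i) (hg i),
          ← lintegral_indicator (h.measurableSet_label i _)]
        refine lintegral_congr fun ω => ?_
        simp [hF, Set.indicator]

/-- A bound for the conditional expectation of a product over the sample that holds for each label
vector in `A` holds for the expectation on the event that the labels lie in `A`. -/
lemma IsSample.setLIntegral_prod_le (h : IsSample P M c x) (hn : 0 < n) (hπ : ∀ k, 0 < M.prior k)
    (A : Set (Fin n → Fin K))
    {φ : (Fin n → Fin K) → Fin n → EuclideanSpace ℝ (Fin p) → ENNReal}
    (hφ : ∀ κ i, Measurable (φ κ i)) {L : ENNReal}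
    (hL : ∀ κ ∈ A, ∏ i, ∫⁻ y, φ κ i y ∂multivariateGaussian (M.mean (κ i)) M.covW ≤ L) :
    ∫⁻ ω in {ω | (fun i => c i ω) ∈ A}, ∏ i, φ (fun i => c i ω) i (x i ω) ∂P ≤ L := by
  classical
  have hset : ∀ κ : Fin n → Fin K, MeasurableSet {ω | (fun i => c i ω) = κ} := fun κ =>
    (measurable_pi_lambda _ h.measurable_label) (measurableSet_singleton κ)
  have hU : {ω | (fun i => c i ω) ∈ A}
      = ⋃ κ ∈ A.toFinset, {ω | (fun i => c i ω) = κ} := by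
    ext ω; simp
  rw [hU, lintegral_biUnion_finset
    (fun κ _ κ' _ hne => Set.disjoint_left.2 fun ω h1 h2 => hne (h1.symm.trans h2))
    (fun κ _ => hset κ)]
  calc _ ≤ ∑ κ ∈ A.toFinset, (∏ i, ENNReal.ofReal (M.prior (κ i))) * L := by
        refine Finset.sum_le_sum fun κ hκ => ?_
        rw [setLIntegral_congr_fun (g := fun ω => ∏ i, φ κ i (x i ω)) (hset κ)
          (fun ω hω => by rw [Set.mem_ofPred_eq] at hω; simp only [hω]),
          h.setLIntegral_prod hπ κ (hφ κ), Finset.prod_mul_distrib]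
        gcongr
        exact hL κ (by simpa using hκ)
    _ ≤ ∑ κ : Fin n → Fin K, (∏ i, ENNReal.ofReal (M.prior (κ i))) * L :=
        Finset.sum_le_sum_of_subset (Finset.subset_univ _)
    _ = L := by
        rw [← Finset.sum_mul, ← Fintype.piFinset_univ, ← Finset.prod_univ_sum (fun _ => Finset.univ)
          (fun (_ : Fin n) k => ENNReal.ofReal (M.prior k))]
        simp [h.sum_ofReal_prior ⟨0, hn⟩]

lemma IsSample.lintegral_prod_label (h : IsSample P M c x) (G : Fin K → ENNReal) :
    ∫⁻ ω, ∏ i, G (c i ω) ∂P = (∑ k, ENNReal.ofReal (M.prior k) * G k) ^ n := by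
  have hind := h.indep.comp (fun _ z => G z.1)
    fun _ => (measurable_of_finite G).comp measurable_fst
  have hprod := lintegral_prod_eq_prod_lintegral_of_indepFun Finset.univ _ hind
    fun i => (measurable_of_finite G).comp (h.measurable_label i)
  simp only [Function.comp] at hprod
  rw [hprod]
  simp [h.lintegral_label]

/-! ### The marginal covariance matrix -/

lemma IsSample.map_feature (h : IsSample P M c x) (hπ : ∀ k, 0 < M.prior k) (i : Fin n) :
    P.map (x i) =
      ∑ k, ENNReal.ofReal (M.prior k) • multivariateGaussian (M.mean k) M.covW := by
  refine Measure.ext_of_lintegral _ fun f hf => ?_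
  rw [lintegral_map hf (h.measurable_feature i), lintegral_finsetSum_measure]
  simp_rw [lintegral_smul_measure, smul_eq_mul, ← h.setLIntegral_feature hπ i _ hf]
  rw [← lintegral_biUnion_finset
    (fun k _ k' _ hne => Set.disjoint_left.2 fun ω h1 h2 => hne (h1.symm.trans h2))
    (fun k _ => h.measurableSet_label i k)]
  have : (⋃ k ∈ Finset.univ, {ω | c i ω = k}) = Set.univ := by ext ω; simp
  rw [this, Measure.restrict_univ]

lemma IsSample.integral_feature (h : IsSample P M c x) (hπ : ∀ k, 0 < M.prior k) (i : Fin n)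
    {f : EuclideanSpace ℝ (Fin p) → ℝ} (hfm : Measurable f)
    (hf : ∀ k, Integrable f (multivariateGaussian (M.mean k) M.covW)) :
    ∫ ω, f (x i ω) ∂P
      = ∑ k, M.prior k * ∫ y, f y ∂multivariateGaussian (M.mean k) M.covW := by
  rw [← integral_map (h.measurable_feature i).aemeasurable hfm.aestronglyMeasurable,
    h.map_feature hπ, integral_finsetSum_measure fun k _ =>
      (hf k).smul_measure ENNReal.ofReal_ne_top]
  refine Finset.sum_congr rfl fun k _ => ?_
  rw [integral_smul_measure, ENNReal.toReal_ofReal (hπ k).le, smul_eq_mul]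

/-- The marginal covariance is the sum of the within-class and the between-class covariances. -/
lemma IsSample.covMat_apply (h : IsSample P M c x) (hπ : ∀ k, 0 < M.prior k)
    (hS : M.covW.PosSemidef) (hμ : ∑ k, M.prior k • M.mean k = 0) (i : Fin n) (a b : Fin p) :
    covMat P (x i) a b = M.covW a b + ∑ k, M.prior k * (M.mean k a * M.mean k b) := by
  have hLp : ∀ k (a : Fin p), MemLp (fun y : EuclideanSpace ℝ (Fin p) => y a) 2
      (multivariateGaussian (M.mean k) M.covW) := fun k a =>
    (IsGaussian.memLp_two_id (μ := multivariateGaussian (M.mean k) M.covW)).continuousLinearMap_comp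
      (EuclideanSpace.proj a : EuclideanSpace ℝ (Fin p) →L[ℝ] ℝ)
  have hmean : ∀ k (a : Fin p), ∫ y, y a ∂multivariateGaussian (M.mean k) M.covW = M.mean k a := by
    intro k a
    have := (EuclideanSpace.proj a : EuclideanSpace ℝ (Fin p) →L[ℝ] ℝ).integral_comp_id_comm
      (IsGaussian.integrable_id (μ := multivariateGaussian (M.mean k) M.covW))
    simpa using this
  have h0 : ∀ a : Fin p, ∫ ω, x i ω a ∂P = 0 := by
    intro a
    rw [h.integral_feature hπ i (f := fun y => y a) (by fun_prop)
      fun k => (hLp k a).integrable (by norm_num)]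
    simp_rw [hmean]
    simpa using congrArg (fun v : EuclideanSpace ℝ (Fin p) => v a) hμ
  have hs := h.sum_prior i
  simp only [covMat, Matrix.of_apply, covariance, h0, sub_zero]
  rw [h.integral_feature hπ i (f := fun y => y a * y b) (by fun_prop)
    fun k => (hLp k a).integrable_mul (hLp k b)]
  have hk : ∀ k, ∫ y, y a * y b ∂multivariateGaussian (M.mean k) M.covW
      = M.covW a b + M.mean k a * M.mean k b := by
    intro k
    have h1 := covariance_eq_sub (hLp k a) (hLp k b)
    rw [covariance_eval_multivariateGaussian hS, hmean, hmean] at h1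
    simp only [Pi.mul_apply] at h1
    linarith
  simp_rw [hk, mul_add, Finset.sum_add_distrib, ← Finset.sum_mul, hs, one_mul]

end OptimalScoring

/-! ### The score matrix as a weighted Helmert matrix -/

namespace OptimalScoring

/-- The weighted Helmert matrix of class weights `w`: its columns are orthonormal for the inner
product `∑ k, w k * f k * g k`, and orthogonal to constants. The score matrix is the one of the
empirical class frequencies, and `Δ` is obtained from the one of the class probabilities. -/
noncomputable def helmert {K : ℕ} (w : Fin K → ℝ) : Matrix (Fin K) (Fin (K - 1)) ℝ :=
  Matrix.of fun k l =>
    if k.val < l.val + 1 then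
      √(w (nextClass l) / (partialSum w (l.val + 1) * (partialSum w (l.val + 1) + w (nextClass l))))
    else if k = nextClass l then
      -√(partialSum w (l.val + 1) / (w (nextClass l) * (partialSum w (l.val + 1) + w (nextClass l))))
    else 0

variable {n p K : ℕ}

lemma partialSum_succ (w : Fin K → ℝ) (l : Fin (K - 1)) :
    partialSum w (l.val + 2) = partialSum w (l.val + 1) + w (nextClass l) := by
  unfold partialSum
  have : (Finset.univ.filter fun k : Fin K => k.val < l.val + 2)
      = insert (nextClass l) (Finset.univ.filter fun k : Fin K => k.val < l.val + 1) := by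
    ext k
    simp only [Finset.mem_filter, Finset.mem_univ, true_and, Finset.mem_insert, nextClass,
      Fin.ext_iff]
    omega
  rw [this, Finset.sum_insert (by simp [nextClass]), add_comm]

lemma partialSum_pos {w : Fin K → ℝ} (hw : ∀ k, 0 < w k) (l : Fin (K - 1)) :
    0 < partialSum w (l.val + 1) :=
  Finset.sum_pos (fun k _ => hw k) ⟨⟨0, by have := l.isLt; omega⟩, by simp⟩

lemma partialSum_mono {w w' : Fin K → ℝ} (h : ∀ k, w k ≤ w' k) (m : ℕ) :
    partialSum w m ≤ partialSum w' m :=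
  Finset.sum_le_sum fun k _ => h k

lemma partialSum_const_mul (a : ℝ) (w : Fin K → ℝ) (m : ℕ) :
    partialSum (fun k => a * w k) m = a * partialSum w m := by
  simp [partialSum, Finset.mul_sum]

lemma sum_mul_helmert (w g : Fin K → ℝ) (l : Fin (K - 1)) :
    ∑ k, g k * helmert w k l =
      √(w (nextClass l) / (partialSum w (l.val + 1) * (partialSum w (l.val + 1) + w (nextClass l))))
          * partialSum g (l.val + 1)
        - √(partialSum w (l.val + 1) /
            (w (nextClass l) * (partialSum w (l.val + 1) + w (nextClass l)))) * g (nextClass l) := by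
  set A := √(w (nextClass l) /
    (partialSum w (l.val + 1) * (partialSum w (l.val + 1) + w (nextClass l)))) with hA
  set B := √(partialSum w (l.val + 1) /
    (w (nextClass l) * (partialSum w (l.val + 1) + w (nextClass l)))) with hB
  have h : ∀ k, g k * helmert w k l =
      (if k.val < l.val + 1 then A * g k else 0) - (if k = nextClass l then B * g k else 0) := by
    intro k
    simp only [helmert, Matrix.of_apply, ← hA, ← hB]
    by_cases h1 : k.val < l.val + 1
    · have : k ≠ nextClass l := by rintro rfl; simp [nextClass] at h1
      simp [h1, this, mul_comm]
    · by_cases h2 : k = nextClass l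
      · simp [h2, mul_comm, nextClass]
      · simp [h1, h2]
  simp_rw [h, Finset.sum_sub_distrib]
  rw [Finset.sum_ite_eq' Finset.univ (nextClass l), ← Finset.sum_filter, ← Finset.mul_sum]
  simp [partialSum]

lemma sqrt_div_mul_balance {a b : ℝ} (ha : 0 < a) (hb : 0 < b) :
    √(a / (b * (b + a))) * b = √(b / (a * (b + a))) * a := by
  rw [Real.sqrt_div ha.le, Real.sqrt_div hb.le, Real.sqrt_mul ha.le, Real.sqrt_mul hb.le]
  have h1 : √a ≠ 0 := by positivity
  have h2 : √b ≠ 0 := by positivity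
  have h3 : √(b + a) ≠ 0 := by positivity
  field_simp
  rw [Real.sq_sqrt hb.le, Real.sq_sqrt ha.le, mul_comm]

lemma sum_weight_mul_helmert {w : Fin K → ℝ} (hw : ∀ k, 0 < w k) (l : Fin (K - 1)) :
    ∑ k, w k * helmert w k l = 0 := by
  rw [sum_mul_helmert]
  have hb := partialSum_pos hw l
  have ha := hw (nextClass l)
  rw [sqrt_div_mul_balance ha hb, sub_self]

lemma sum_weight_mul_helmert_sq {w : Fin K → ℝ} (hw : ∀ k, 0 < w k) (l : Fin (K - 1)) :
    ∑ k, w k * helmert w k l * helmert w k l = 1 := by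
  rw [sum_mul_helmert]
  have hb := partialSum_pos hw l
  have ha := hw (nextClass l)
  have h1 : partialSum (fun k => w k * helmert w k l) (l.val + 1) =
      √(w (nextClass l) /
        (partialSum w (l.val + 1) * (partialSum w (l.val + 1) + w (nextClass l))))
        * partialSum w (l.val + 1) := by
    conv_rhs => rw [partialSum, Finset.mul_sum]
    refine Finset.sum_congr rfl fun k hk => ?_
    simp only [Finset.mem_filter, Finset.mem_univ, true_and] at hk
    show w k * helmert w k l = _
    rw [helmert, Matrix.of_apply, if_pos hk, mul_comm]
    rfl
  have h2 : helmert w (nextClass l) l = -√(partialSum w (l.val + 1) /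
      (w (nextClass l) * (partialSum w (l.val + 1) + w (nextClass l)))) := by
    simp [helmert, nextClass]
  rw [h1, h2]
  set b := partialSum w (l.val + 1)
  set a := w (nextClass l)
  have e1 : √(a / (b * (b + a))) ^ 2 = a / (b * (b + a)) := Real.sq_sqrt (by positivity)
  have e2 : √(b / (a * (b + a))) ^ 2 = b / (a * (b + a)) := Real.sq_sqrt (by positivity)
  calc _ = √(a / (b * (b + a))) ^ 2 * b + √(b / (a * (b + a))) ^ 2 * a := by ring
    _ = 1 := by rw [e1, e2]; field_simp; ring

lemma helmert_orthogonal_of_lt {w : Fin K → ℝ} (hw : ∀ k, 0 < w k) {r s : Fin (K - 1)}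
    (hrs : r < s) : ∑ k, w k * helmert w k r * helmert w k s = 0 := by
  have hz : ∀ k : Fin K, s.val + 1 ≤ k.val → helmert w k r = 0 := by
    intro k hk
    have hrs' : r.val < s.val := hrs
    have h1 : ¬ k.val < r.val + 1 := by omega
    have h2 : k ≠ nextClass r := by
      intro h; rw [h] at hk; simp only [nextClass] at hk; omega
    rw [helmert, Matrix.of_apply, if_neg h1, if_neg h2]
  rw [sum_mul_helmert]
  have h1 : partialSum (fun k => w k * helmert w k r) (s.val + 1) = 0 := by
    rw [← sum_weight_mul_helmert hw r, partialSum]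
    refine Finset.sum_subset (Finset.subset_univ _) fun k _ hk => ?_
    simp only [Finset.mem_filter, Finset.mem_univ, true_and, not_lt] at hk
    rw [hz k hk, mul_zero]
  rw [h1, hz (nextClass s) (by simp [nextClass])]
  simp

lemma helmert_orthonormal {w : Fin K → ℝ} (hw : ∀ k, 0 < w k) (r s : Fin (K - 1)) :
    ∑ k, w k * helmert w k r * helmert w k s = if r = s then 1 else 0 := by
  rcases lt_trichotomy r s with h | rfl | h
  · rw [helmert_orthogonal_of_lt hw h, if_neg h.ne]
  · rw [sum_weight_mul_helmert_sq hw, if_pos rfl]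
  · rw [if_neg h.ne', ← helmert_orthogonal_of_lt hw h]
    exact Finset.sum_congr rfl fun k _ => by ring

lemma helmert_isometry {w : Fin K → ℝ} (hw : ∀ k, 0 < w k) (f : Fin (K - 1) → ℝ) :
    ∑ k, w k * (∑ r, helmert w k r * f r) ^ 2 = ∑ r, f r ^ 2 := by
  calc _ = ∑ r, ∑ s, f r * f s * ∑ k, w k * helmert w k r * helmert w k s := by
        simp_rw [sq, Finset.sum_mul_sum, Finset.mul_sum]
        rw [Finset.sum_comm]
        refine Finset.sum_congr rfl fun r _ => ?_
        rw [Finset.sum_comm]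
        exact Finset.sum_congr rfl fun s _ => Finset.sum_congr rfl fun k _ => by ring
    _ = _ := by
        simp_rw [helmert_orthonormal hw]
        simp [sq]

/-- The transpose of a contraction is a contraction for the dual norm. -/
lemma sum_sq_dual_le {κ ι : Type*} [Fintype κ] [Fintype ι] {w : κ → ℝ} (hw : ∀ k, 0 < w k)
    {A : κ → ι → ℝ} (hA : ∀ f : ι → ℝ, ∑ k, w k * (∑ r, A k r * f r) ^ 2 ≤ ∑ r, f r ^ 2)
    (e : κ → ℝ) : ∑ r, (∑ k, e k * A k r) ^ 2 ≤ ∑ k, e k ^ 2 / w k := by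
  set f : ι → ℝ := fun r => ∑ k, e k * A k r with hf
  set Q := ∑ r, f r ^ 2 with hQ
  have h1 : Q = ∑ k, e k * ∑ r, A k r * f r := by
    simp_rw [Finset.mul_sum]
    rw [Finset.sum_comm, hQ]
    refine Finset.sum_congr rfl fun r _ => ?_
    conv_lhs => rw [sq, hf]
    simp only []
    rw [Finset.sum_mul]
    exact Finset.sum_congr rfl fun k _ => by ring
  have h2 : Q ^ 2 ≤ (∑ k, e k ^ 2 / w k) * Q := by
    calc Q ^ 2 = (∑ k, (e k / √(w k)) * (√(w k) * ∑ r, A k r * f r)) ^ 2 := by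
          rw [h1]; congr 1
          refine Finset.sum_congr rfl fun k _ => ?_
          have : √(w k) ≠ 0 := (Real.sqrt_pos.2 (hw k)).ne'
          field_simp
      _ ≤ (∑ k, (e k / √(w k)) ^ 2) * ∑ k, (√(w k) * ∑ r, A k r * f r) ^ 2 :=
          Finset.sum_mul_sq_le_sq_mul_sq _ _ _
      _ = (∑ k, e k ^ 2 / w k) * ∑ k, w k * (∑ r, A k r * f r) ^ 2 := by
          congr 1 <;> refine Finset.sum_congr rfl fun k _ => ?_
          · rw [div_pow, Real.sq_sqrt (hw k).le]
          · rw [mul_pow, Real.sq_sqrt (hw k).le]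
      _ ≤ _ := by
          gcongr
          · exact Finset.sum_nonneg fun k _ => div_nonneg (sq_nonneg _) (hw k).le
          · exact hA f
  have hQ0 : 0 ≤ Q := Finset.sum_nonneg fun _ _ => sq_nonneg _
  rcases hQ0.eq_or_lt with h | h
  · rw [← h]; exact Finset.sum_nonneg fun k _ => div_nonneg (sq_nonneg _) (hw k).le
  · rw [sq] at h2; exact le_of_mul_le_mul_right h2 h

/-- A Lipschitz bound for the entry `-√(b / (a (a + b)))` of a Helmert matrix, in the scale
`|a' - a| / √a` in which the frequency of an event of probability `a` fluctuates. -/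
lemma mul_abs_sqrt_sub_sqrt_le {a b a' b' : ℝ} (ha : 0 < a) (hb : 0 < b) (ha' : a / 2 ≤ a')
    (hb' : b / 2 ≤ b') :
    a' * |√(b' / (a' * (b' + a'))) - √(b / (a * (b + a)))| ≤
      3 * (|a' - a| / √a) + 2 * (|b' - b| / √b) := by
  have ha'0 : 0 < a' := by linarith
  have hb'0 : 0 < b' := by linarith
  set d := √(b / (a * (b + a))) with hd
  set d' := √(b' / (a' * (b' + a'))) with hd'
  have hd0 : 0 < d := by positivity
  have hd'0 : 0 < d' := by positivity
  have hd2 : d ^ 2 = b / (a * (b + a)) := Real.sq_sqrt (by positivity)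
  have hd'2 : d' ^ 2 = b' / (a' * (b' + a')) := Real.sq_sqrt (by positivity)
  set X := √a
  set Y := √b
  set Z := √(b + a)
  have hX : 0 < X := by positivity
  have hY : 0 < Y := by positivity
  have hZ : 0 < Z := by positivity
  have hXa : a = X ^ 2 := (Real.sq_sqrt ha.le).symm
  have hYb : b = Y ^ 2 := (Real.sq_sqrt hb.le).symm
  have hZc : b + a = Z ^ 2 := (Real.sq_sqrt (by positivity)).symm
  have hdXYZ : d = Y / (X * Z) := by
    rw [hd, Real.sqrt_div hb.le, Real.sqrt_mul ha.le]
  have hXZ : X ≤ Z := Real.sqrt_le_sqrt (by linarith)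
  have hYZ : Y ≤ Z := Real.sqrt_le_sqrt (by linarith)
  have step1 : a' * |d' - d| * d ≤ a' * |d' ^ 2 - d ^ 2| := by
    have : |d' ^ 2 - d ^ 2| = |d' - d| * (d' + d) := by
      rw [sq_sub_sq, abs_mul, abs_of_pos (show 0 < d' + d by linarith), mul_comm]
    rw [this, mul_assoc]
    gcongr; linarith
  have step2 : a' * |d' ^ 2 - d ^ 2| ≤
      (|b' - b| * a ^ 2 + b * |a' - a| * (a + a' + b')) / (a * (b + a) * (b' + a')) := by
    have : a' * (d' ^ 2 - d ^ 2) =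
        ((b' - b) * a ^ 2 - b * ((a' - a) * (a + a' + b'))) / (a * (b + a) * (b' + a')) := by
      rw [hd2, hd'2]; field_simp; ring
    rw [← abs_of_pos ha'0, ← abs_mul, abs_of_pos ha'0, this, abs_div,
      abs_of_pos (show 0 < a * (b + a) * (b' + a') by positivity)]
    gcongr
    refine (abs_sub _ _).trans (le_of_eq ?_)
    rw [abs_mul, abs_mul, abs_mul, abs_of_pos hb, abs_of_pos (show 0 < a + a' + b' by linarith),
      abs_of_nonneg (sq_nonneg a)]
    ring
  have step3 : (|b' - b| * a ^ 2 + b * |a' - a| * (a + a' + b')) / (a * (b + a) * (b' + a')) ≤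
      (3 * (|a' - a| / X) + 2 * (|b' - b| / Y)) * d := by
    have h1 : |b' - b| * a ^ 2 / (a * (b + a) * (b' + a')) ≤ 2 * (|b' - b| / Y) * d := by
      have e1 : |b' - b| * a ^ 2 / (a * (b + a) * (b' + a'))
          = |b' - b| * (a / ((b + a) * (b' + a'))) := by field_simp
      have e2 : 2 * (|b' - b| / Y) * d = |b' - b| * (2 / (X * Z)) := by
        rw [hdXYZ]; field_simp
      rw [e1, e2]
      refine mul_le_mul_of_nonneg_left ?_ (abs_nonneg _)
      calc a / ((b + a) * (b' + a')) ≤ 2 / (b + a) := by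
            rw [div_le_div_iff₀ (by positivity) (by positivity)]
            nlinarith [mul_pos hb'0 ha, mul_pos hb'0 hb, mul_nonneg (sub_nonneg.2 ha')
              (add_pos hb ha).le]
        _ ≤ 2 / (X * Z) := by rw [hZc, sq]; gcongr
    have h2 : b * |a' - a| * (a + a' + b') / (a * (b + a) * (b' + a')) ≤
        3 * (|a' - a| / X) * d := by
      have e1 : b * |a' - a| * (a + a' + b') / (a * (b + a) * (b' + a'))
          = |a' - a| * ((a + a' + b') / (b' + a')) * (Y * Y / (X ^ 2 * (Z * Z))) := by
        rw [hZc, hYb, hXa]; field_simp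
      have e2 : 3 * (|a' - a| / X) * d = |a' - a| * 3 * (Y * Z / (X ^ 2 * (Z * Z))) := by
        rw [hdXYZ]; field_simp
      rw [e1, e2]
      gcongr
      rw [div_le_iff₀ (by positivity)]; linarith
    calc _ = |b' - b| * a ^ 2 / (a * (b + a) * (b' + a')) +
          b * |a' - a| * (a + a' + b') / (a * (b + a) * (b' + a')) := add_div _ _ _
      _ ≤ _ := by linarith
  exact le_of_mul_le_mul_right (step1.trans (step2.trans step3)) hd0

/-! ### The population regression coefficients -/

lemma Model.contrast_apply (M : Model p K) (hπ : ∀ k, 0 < M.prior k) (j : Fin p)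
    (r : Fin (K - 1)) :
    M.contrast j r = ∑ k, M.prior k * M.mean k j * helmert M.prior k r := by
  rw [sum_mul_helmert]
  simp only [Model.contrast, Matrix.of_apply, partialSum_succ]
  have hb := partialSum_pos hπ r
  have ha := hπ (nextClass r)
  have hsum : ∑ k : Fin K with k.val < r.val + 1,
      M.prior k * (M.mean k j - M.mean (nextClass r) j) =
      partialSum (fun k => M.prior k * M.mean k j) (r.val + 1)
        - partialSum M.prior (r.val + 1) * M.mean (nextClass r) j := by
    simp only [partialSum, mul_sub, Finset.sum_sub_distrib, Finset.sum_mul]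
  rw [hsum]
  set b := partialSum M.prior (r.val + 1)
  set a := M.prior (nextClass r)
  have e1 : √(a / (b * (b + a))) = √a / √(b * (b + a)) := Real.sqrt_div ha.le _
  have e2 : √(b / (a * (b + a))) * a = √a * b / √(b * (b + a)) := by
    rw [← sqrt_div_mul_balance ha hb, e1]; ring
  rw [← mul_assoc (√(b / (a * (b + a)))), e1, e2]
  ring

/-- The inner product of the class mean `μ_k` with the `r`-th column of `B*`. -/
noncomputable def Model.fittedMean (M : Model p K) (covT : Matrix (Fin p) (Fin p) ℝ)
    (k : Fin K) (r : Fin (K - 1)) : ℝ :=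
  ∑ a, M.mean k a * M.coef covT a r

/-- The normal equation `Δ = Σ_T B*`, with `Σ_T` split into its within-class and between-class
parts. -/
lemma Model.contrast_eq {M : Model p K} {covT : Matrix (Fin p) (Fin p) ℝ}
    (hT : ∀ a b, covT a b = M.covW a b + ∑ k, M.prior k * (M.mean k a * M.mean k b))
    (hdet : IsUnit covT.det) (j : Fin p) (r : Fin (K - 1)) :
    M.contrast j r = ∑ a, M.covW j a * M.coef covT a r
      + ∑ k, M.prior k * M.mean k j * M.fittedMean covT k r := by
  have h : covT * M.coef covT = M.contrast := by
    rw [Model.coef, ← Matrix.mul_assoc, Matrix.mul_nonsing_inv _ hdet, Matrix.one_mul]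
  rw [← h, Matrix.mul_apply]
  simp_rw [hT, add_mul, Finset.sum_add_distrib, Model.fittedMean, Finset.mul_sum, Finset.sum_mul]
  congr 1
  rw [Finset.sum_comm]
  exact Finset.sum_congr rfl fun k _ => Finset.sum_congr rfl fun a _ => by ring

open Matrix in
/-- Both parts of the variance of a linear combination of the fitted values are at most the variance
of the same combination of the scores. -/
lemma Model.fitted_variance_le {M : Model p K} {covT : Matrix (Fin p) (Fin p) ℝ}
    (hπ : ∀ k, 0 < M.prior k) (hS : M.covW.PosSemidef)
    (hT : ∀ a b, covT a b = M.covW a b + ∑ k, M.prior k * (M.mean k a * M.mean k b))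
    (hdet : IsUnit covT.det) (f : Fin (K - 1) → ℝ) :
    ∑ k, M.prior k * (∑ r, M.fittedMean covT k r * f r) ^ 2 ≤ ∑ r, f r ^ 2 ∧
    (M.coef covT *ᵥ f) ⬝ᵥ M.covW *ᵥ (M.coef covT *ᵥ f) ≤ ∑ r, f r ^ 2 := by
  set b := M.coef covT *ᵥ f with hb
  set g : Fin K → ℝ := fun k => ∑ r, M.fittedMean covT k r * f r with hg
  have hgb : ∀ k, g k = ∑ a, b a * M.mean k a := by
    intro k
    simp only [hg, hb, Model.fittedMean, mulVec, dotProduct, Finset.sum_mul]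
    rw [Finset.sum_comm]
    exact Finset.sum_congr rfl fun a _ => Finset.sum_congr rfl fun r _ => by ring
  set S := ∑ k, M.prior k * g k ^ 2 with hSdef
  set V := b ⬝ᵥ M.covW *ᵥ b with hV
  set F := ∑ r, f r ^ 2 with hF
  have hV0 : 0 ≤ V := by simpa using hS.dotProduct_mulVec_nonneg b
  have hS0 : 0 ≤ S := Finset.sum_nonneg fun k _ => mul_nonneg (hπ k).le (sq_nonneg _)
  have hF0 : 0 ≤ F := Finset.sum_nonneg fun k _ => sq_nonneg _
  have hcontr : ∀ j, ∑ r, M.contrast j r * f r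
      = (M.covW *ᵥ b) j + ∑ k, M.prior k * M.mean k j * g k := by
    intro j
    simp_rw [M.contrast_eq hT hdet j, add_mul, Finset.sum_add_distrib]
    congr 1
    · simp only [hb, mulVec, dotProduct, Finset.mul_sum, Finset.sum_mul]
      rw [Finset.sum_comm]
      exact Finset.sum_congr rfl fun a _ => Finset.sum_congr rfl fun r _ => by ring
    · simp only [hg, Finset.mul_sum, Finset.sum_mul]
      rw [Finset.sum_comm]
      exact Finset.sum_congr rfl fun a _ => Finset.sum_congr rfl fun r _ => by ring
  have hVS : V + S = ∑ j, b j * ∑ r, M.contrast j r * f r := by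
    simp_rw [hcontr, mul_add, Finset.sum_add_distrib]
    congr 1
    simp_rw [hSdef, Finset.mul_sum]
    rw [Finset.sum_comm]
    refine Finset.sum_congr rfl fun k _ => ?_
    rw [sq]
    nth_rewrite 1 [hgb k]
    rw [Finset.sum_mul, Finset.mul_sum]
    exact Finset.sum_congr rfl fun a _ => by ring
  have hcross : ∑ j, b j * ∑ r, M.contrast j r * f r
      = ∑ k, M.prior k * g k * ∑ r, helmert M.prior k r * f r := by
    have : ∀ j, ∑ r, M.contrast j r * f r
        = ∑ k, M.prior k * M.mean k j * ∑ r, helmert M.prior k r * f r := by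
      intro j
      simp_rw [M.contrast_apply hπ, Finset.mul_sum, Finset.sum_mul]
      rw [Finset.sum_comm]
      exact Finset.sum_congr rfl fun a _ => Finset.sum_congr rfl fun r _ => by ring
    obtain ⟨h, hh⟩ : ∃ h : Fin K → ℝ, ∀ k, ∑ r, helmert M.prior k r * f r = h k := ⟨_, fun _ => rfl⟩
    simp_rw [this, hh]
    simp_rw [Finset.mul_sum]
    rw [Finset.sum_comm]
    refine Finset.sum_congr rfl fun k _ => ?_
    rw [hgb k, Finset.mul_sum, Finset.sum_mul]
    exact Finset.sum_congr rfl fun a _ => by ring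
  have hCS : (V + S) ^ 2 ≤ S * F := by
    rw [hVS, hcross, hF, ← helmert_isometry hπ f]
    calc _ = (∑ k, (√(M.prior k) * g k) *
          (√(M.prior k) * ∑ r, helmert M.prior k r * f r)) ^ 2 := by
          congr 1
          refine Finset.sum_congr rfl fun k _ => ?_
          nth_rewrite 1 [← Real.mul_self_sqrt (hπ k).le]
          ring
      _ ≤ _ := Finset.sum_mul_sq_le_sq_mul_sq _ _ _
      _ = _ := by
          congr 1 <;> refine Finset.sum_congr rfl fun k _ => ?_ <;>
            rw [mul_pow, Real.sq_sqrt (hπ k).le]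
  have hSF : S ≤ F := by
    rcases hS0.eq_or_lt with h | h
    · rw [← h]; exact hF0
    · have : S * S ≤ S * F := by nlinarith
      exact le_of_mul_le_mul_left this h
  refine ⟨hSF, ?_⟩
  refine le_of_sq_le_sq ?_ hF0
  nlinarith

end OptimalScoring

/-! ### Concentration of the class frequencies -/

namespace OptimalScoring

/-- The relative frequency `n_k / n` of class `k`. -/
noncomputable def freq {n K : ℕ} (c : Fin n → Fin K) (k : Fin K) : ℝ :=
  (classCount c k : ℝ) / n

section

variable {n K : ℕ}

lemma classCount_eq_sum (c : Fin n → Fin K) (k : Fin K) :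
    (classCount c k : ℝ) = ∑ i, if c i = k then 1 else 0 := by
  rw [classCount, Fintype.card_subtype, Finset.sum_boole]

lemma sum_freq_mul (c : Fin n → Fin K) (g : Fin K → ℝ) :
    ∑ k, freq c k * g k = (∑ i, g (c i)) / n := by
  simp_rw [freq, classCount_eq_sum, div_mul_eq_mul_div, Finset.sum_mul, ← Finset.sum_div]
  rw [Finset.sum_comm]
  simp

lemma sum_freq (c : Fin n → Fin K) (S : Finset (Fin K)) :
    ∑ k ∈ S, freq c k = (∑ i, if c i ∈ S then 1 else 0) / n := by
  rw [← sum_freq_mul c fun k => if k ∈ S then 1 else 0]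
  simp

lemma scoreMatrix_eq_helmert (hn : 0 < n) (c : Fin n → Fin K) :
    scoreMatrix c = helmert (freq c) := by
  have hn' : (n : ℝ) ≠ 0 := by positivity
  have hf : ∀ m, partialSum (freq c) m
      = (n : ℝ)⁻¹ * partialSum (fun k => (classCount c k : ℝ)) m := by
    intro m
    rw [← partialSum_const_mul]
    congr 1; ext k; rw [freq, div_eq_inv_mul]
  ext k l
  simp only [scoreMatrix, helmert, Matrix.of_apply, partialSum_succ, hf]
  simp only [freq]
  split_ifs with h1 h2
  · congr 1; field_simp
  · congr 2; field_simp
  · rfl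

end

variable {Ω : Type*} [MeasurableSpace Ω] {n p K : ℕ} {P : Measure Ω} {M : Model p K}
  {c : Fin n → Ω → Fin K} {x : Fin n → Ω → EuclideanSpace ℝ (Fin p)}

lemma IsSample.measurable_comp_label (h : IsSample P M c x) {β : Type*} [MeasurableSpace β]
    (f : (Fin n → Fin K) → β) : Measurable fun ω => f fun i => c i ω :=
  (measurable_of_finite f).comp (measurable_pi_lambda _ h.measurable_label)

variable [IsProbabilityMeasure P]

lemma sum_mul_exp_indicator_sub_le {w : Fin K → ℝ} (hw : ∀ k, 0 < w k) (hw1 : ∑ k, w k = 1)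
    (S : Finset (Fin K)) {y : ℝ} (hy : |y| ≤ 1) :
    ∑ k, w k * Real.exp (y * ((if k ∈ S then 1 else 0) - ∑ k ∈ S, w k)) ≤
      Real.exp (y ^ 2 * ∑ k ∈ S, w k) := by
  set q := ∑ k ∈ S, w k with hq
  have hq0 : 0 ≤ q := Finset.sum_nonneg fun k _ => (hw k).le
  have hq1 : q ≤ 1 := by
    rw [← hw1]; exact Finset.sum_le_sum_of_subset_of_nonneg (Finset.subset_univ _)
      fun k _ _ => (hw k).le
  have hI : ∑ k, w k * (if k ∈ S then (1 : ℝ) else 0) = q := by simp [hq]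
  have hpt : ∀ k, w k * Real.exp (y * ((if k ∈ S then 1 else 0) - q)) ≤
      w k + (y * (w k * (if k ∈ S then (1 : ℝ) else 0)) - y * q * w k)
        + y ^ 2 * ((1 - 2 * q) * (w k * (if k ∈ S then (1 : ℝ) else 0)) + q ^ 2 * w k) := by
    intro k
    set z : ℝ := (if k ∈ S then 1 else 0) - q with hz
    have hz1 : |z| ≤ 1 := by
      rw [hz]; split_ifs <;> rw [abs_le] <;> constructor <;> linarith
    have h1 : |y * z| ≤ 1 := by
      rw [abs_mul]; exact mul_le_one₀ hy (abs_nonneg _) hz1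
    have h2 := (abs_le.1 (Real.abs_exp_sub_one_sub_id_le h1)).2
    have h3 : Real.exp (y * z) ≤ 1 + y * z + (y * z) ^ 2 := by linarith
    refine (mul_le_mul_of_nonneg_left h3 (hw k).le).trans (le_of_eq ?_)
    rw [hz]; split_ifs <;> ring
  calc _ ≤ _ := Finset.sum_le_sum fun k _ => hpt k
    _ = 1 + y ^ 2 * (q - q ^ 2) := by
        simp only [Finset.sum_add_distrib, Finset.sum_sub_distrib, ← Finset.mul_sum, hI, hw1]
        ring
    _ ≤ y ^ 2 * q + 1 := by nlinarith [mul_nonneg (sq_nonneg y) (sq_nonneg q)]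
    _ ≤ _ := Real.add_one_le_exp _

/-- The standardised frequency of a set of classes is sub-Gaussian in the range where the expected
count dominates the exponent. -/
lemma IsSample.lintegral_exp_freq_le (h : IsSample P M c x) (hn : 0 < n)
    (hπ : ∀ k, 0 < M.prior k) (S : Finset (Fin K)) (hS : 0 < ∑ k ∈ S, M.prior k) {s : ℝ}
    (hs : |s| ≤ n * √(∑ k ∈ S, M.prior k)) :
    ∫⁻ ω, ENNReal.ofReal (Real.exp (s * ((∑ k ∈ S, freq (fun i => c i ω) k
        - ∑ k ∈ S, M.prior k) / √(∑ k ∈ S, M.prior k)))) ∂P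
      ≤ ENNReal.ofReal (Real.exp (s ^ 2 / n)) := by
  set q := ∑ k ∈ S, M.prior k with hq
  have hn' : (0 : ℝ) < n := by exact_mod_cast hn
  have hq' : 0 < √q := Real.sqrt_pos.2 hS
  set y : ℝ := s / (n * √q) with hy
  have hy1 : |y| ≤ 1 := by
    rw [hy, abs_div, abs_of_pos (mul_pos hn' hq'), div_le_one (by positivity)]; exact hs
  have hpt : ∀ ω, ENNReal.ofReal (Real.exp (s * ((∑ k ∈ S, freq (fun i => c i ω) k - q) / √q)))
      = ∏ i, ENNReal.ofReal (Real.exp (y * ((if c i ω ∈ S then 1 else 0) - q))) := by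
    intro ω
    rw [← ENNReal.ofReal_prod_of_nonneg (fun _ _ => Real.exp_nonneg _), ← Real.exp_sum, sum_freq,
      ← Finset.mul_sum, Finset.sum_sub_distrib]
    congr 2
    simp only [Finset.sum_const, Finset.card_univ, Fintype.card_fin, nsmul_eq_mul]
    rw [hy]; field_simp
  simp_rw [hpt]
  rw [h.lintegral_prod_label fun k =>
    ENNReal.ofReal (Real.exp (y * ((if k ∈ S then 1 else 0) - q)))]
  simp_rw [← ENNReal.ofReal_mul (hπ _).le]
  rw [← ENNReal.ofReal_sum_of_nonneg fun k _ => mul_nonneg (hπ k).le (Real.exp_nonneg _),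
    ← ENNReal.ofReal_pow (Finset.sum_nonneg fun k _ => mul_nonneg (hπ k).le (Real.exp_nonneg _))]
  apply ENNReal.ofReal_le_ofReal
  have hb := sum_mul_exp_indicator_sub_le hπ (h.sum_prior ⟨0, hn⟩) S hy1
  calc _ ≤ Real.exp (y ^ 2 * q) ^ n :=
        pow_le_pow_left₀ (Finset.sum_nonneg fun k _ => mul_nonneg (hπ k).le (Real.exp_nonneg _)) hb n
    _ = _ := by
        rw [← Real.exp_nat_mul]; congr 1
        rw [hy, div_pow, mul_pow, Real.sq_sqrt hS.le]; field_simp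

/-- A tail bound for a chi-square type distance between the frequencies and the probabilities of a
family of sets of classes. -/
lemma IsSample.measure_sum_freq_sq_ge_le (h : IsSample P M c x) (hn : 0 < n)
    (hπ : ∀ k, 0 < M.prior k) {ι : Type*} [Fintype ι] [Nonempty ι] (S : ι → Finset (Fin K))
    {q₀ s θ : ℝ} (hq₀ : 0 < q₀) (hS : ∀ r, q₀ ≤ ∑ k ∈ S r, M.prior k) (hs0 : 0 ≤ s)
    (hs : s ≤ n * √q₀) :
    P {ω | Fintype.card ι * θ ^ 2 ≤ ∑ r, (∑ k ∈ S r, freq (fun i => c i ω) k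
        - ∑ k ∈ S r, M.prior k) ^ 2 / ∑ k ∈ S r, M.prior k}
      ≤ ENNReal.ofReal (2 * Real.exp (s ^ 2 / n - s * θ)) := by
  have hpos : ∀ r, 0 < ∑ k ∈ S r, M.prior k := fun r => hq₀.trans_le (hS r)
  have hs' : ∀ r, |s| ≤ n * √(∑ k ∈ S r, M.prior k) := by
    intro r
    rw [abs_of_nonneg hs0]
    refine hs.trans ?_
    gcongr
    exact hS r
  have key := measure_inter_rms_ge_le (P := P) (H := Set.univ) (s := s) (θ := θ)
    (v := fun r ω => (∑ k ∈ S r, freq (fun i => c i ω) k - ∑ k ∈ S r, M.prior k)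
      / √(∑ k ∈ S r, M.prior k))
    (L := ENNReal.ofReal (Real.exp (s ^ 2 / n)))
    (fun r => h.measurable_comp_label fun κ => (∑ k ∈ S r, freq κ k - ∑ k ∈ S r, M.prior k)
      / √(∑ k ∈ S r, M.prior k)) MeasurableSet.univ
    (fun r => by
      rw [Measure.restrict_univ]
      exact h.lintegral_exp_freq_le hn hπ _ (hpos r) (hs' r))
    (fun r => by
      rw [Measure.restrict_univ]
      have := h.lintegral_exp_freq_le hn hπ (S r) (hpos r) (s := -s) (by rw [abs_neg]; exact hs' r)
      rwa [neg_sq] at this)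
  rw [Set.univ_inter, ← ENNReal.ofReal_mul (by positivity), mul_assoc, ← Real.exp_add,
    neg_add_eq_sub] at key
  refine le_trans (le_of_eq ?_) key
  congr 1; ext ω
  simp only [Set.mem_ofPred_eq, div_pow, Real.sq_sqrt (hpos _).le]

/-- The label vectors whose class frequencies are within a factor of the class probabilities, and
for which the chi-square distances of the frequencies, and of their partial sums, to the
probabilities have the expected order. -/
def goodLabels (n : ℕ) {K : ℕ} (w : Fin K → ℝ) (t : ℝ) : Set (Fin n → Fin K) :=
  {κ | (∀ k, |freq κ k - w k| ≤ w k / 2) ∧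
    ∑ k, (freq κ k - w k) ^ 2 / w k ≤ 25 * K * t / n ∧
    ∑ l : Fin (K - 1), (partialSum (freq κ) (l.val + 1) - partialSum w (l.val + 1)) ^ 2
      / partialSum w (l.val + 1) ≤ 25 * K * t / n}

lemma IsSample.measure_compl_goodLabels_le (h : IsSample P M c x) (hn : 0 < n) (hK : 2 ≤ K)
    {q₀ t : ℝ} (hq₀ : 0 < q₀) (hπ : ∀ k, q₀ ≤ M.prior k) (ht : 0 ≤ t) (htn : t ≤ n * q₀) :
    P {ω | (fun i => c i ω) ∉ goodLabels n M.prior t}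
      ≤ ENNReal.ofReal (2 * K * Real.exp (-(n * q₀ / 16)) + 4 * Real.exp (-(4 * t))) := by
  have hn' : (0 : ℝ) < n := by exact_mod_cast hn
  have hπ0 : ∀ k, 0 < M.prior k := fun k => hq₀.trans_le (hπ k)
  have : Nonempty (Fin K) := ⟨⟨0, by omega⟩⟩
  have : Nonempty (Fin (K - 1)) := ⟨⟨0, by omega⟩⟩
  -- `s` balances `s² / n`, the logarithm of the exponential moment, against `s θ`
  set s := √(n * t) with hs
  set θ := 5 * √(t / n) with hθ
  have hθ2 : θ ^ 2 = 25 * (t / n) := by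
    rw [hθ, mul_pow, Real.sq_sqrt (by positivity)]; norm_num
  have hs2 : s ^ 2 / n = t := by rw [hs, Real.sq_sqrt (by positivity)]; field_simp
  have hsθ : s * θ = 5 * t := by
    rw [hs, hθ, mul_left_comm, ← Real.sqrt_mul (by positivity),
      show n * t * (t / n) = t ^ 2 by field_simp, Real.sqrt_sq ht]
  have hsn : s ≤ n * √q₀ := by
    calc s ≤ √(n * (n * q₀)) := Real.sqrt_le_sqrt (by gcongr)
      _ = n * √q₀ := by
        rw [← mul_assoc, Real.sqrt_mul (by positivity), Real.sqrt_mul_self hn'.le]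
  have hchi := h.measure_sum_freq_sq_ge_le hn hπ0 (fun k : Fin K => {k}) (θ := θ) hq₀
    (by simpa using hπ) (Real.sqrt_nonneg _) hsn
  have hchi' := h.measure_sum_freq_sq_ge_le hn hπ0
    (fun l : Fin (K - 1) => Finset.univ.filter fun k : Fin K => k.val < l.val + 1) (θ := θ) hq₀
    (fun l => (hπ ⟨0, by omega⟩).trans
      (Finset.single_le_sum (f := M.prior) (fun k _ => (hπ0 k).le) (by simp)))
    (Real.sqrt_nonneg _) hsn
  simp only [Finset.sum_singleton] at hchi
  rw [hs2, hsθ] at hchi hchi'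
  have hone : ∀ k : Fin K, P {ω | M.prior k / 2 < |freq (fun i => c i ω) k - M.prior k|}
      ≤ ENNReal.ofReal (2 * Real.exp (-(n * q₀ / 16))) := by
    intro k
    have hk := hπ0 k
    have := h.measure_sum_freq_sq_ge_le hn hπ0 (fun _ : Unit => {k}) (θ := √(M.prior k) / 2)
      (s := n * √(M.prior k) / 4) hk (by simp) (by positivity)
      (by have := mul_nonneg hn'.le (Real.sqrt_nonneg (M.prior k)); linarith)
    refine (measure_mono ?_).trans (this.trans (ENNReal.ofReal_le_ofReal ?_))
    · intro ω hω
      simp only [Set.mem_ofPred_eq] at hω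
      simp only [Set.mem_ofPred_eq, Fintype.card_unit, Nat.cast_one, one_mul, Finset.sum_singleton,
        Finset.univ_unique, div_pow, Real.sq_sqrt hk.le]
      rw [le_div_iff₀ hk, ← sq_abs (freq _ _ - _)]
      nlinarith
    · have h1 : (n * √(M.prior k) / 4) ^ 2 / n - n * √(M.prior k) / 4 * (√(M.prior k) / 2)
          = -(n * M.prior k / 16) := by
        have := Real.mul_self_sqrt hk.le
        field_simp
        rw [Real.sq_sqrt hk.le]; ring
      rw [h1]
      gcongr
      exact hπ k
  have hsub : {ω | (fun i => c i ω) ∉ goodLabels n M.prior t} ⊆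
      (⋃ k, {ω | M.prior k / 2 < |freq (fun i => c i ω) k - M.prior k|}) ∪
      ({ω | (Fintype.card (Fin K)) * θ ^ 2 ≤
        ∑ k, (freq (fun i => c i ω) k - M.prior k) ^ 2 / M.prior k} ∪
      {ω | (Fintype.card (Fin (K - 1))) * θ ^ 2 ≤ ∑ l : Fin (K - 1),
        (∑ k : Fin K with k.val < l.val + 1, freq (fun i => c i ω) k
          - ∑ k : Fin K with k.val < l.val + 1, M.prior k) ^ 2
          / ∑ k : Fin K with k.val < l.val + 1, M.prior k}) := by
    intro ω hω
    by_contra hcon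
    simp only [Set.mem_union, Set.mem_iUnion, Set.mem_ofPred_eq, not_or, not_exists, not_lt,
      not_le, hθ2, Fintype.card_fin] at hcon
    obtain ⟨h1, h2, h3⟩ := hcon
    refine hω ⟨h1, h2.le.trans (le_of_eq (by ring)), h3.le.trans ?_⟩
    have : ((K - 1 : ℕ) : ℝ) ≤ K := by exact_mod_cast Nat.sub_le K 1
    calc ((K - 1 : ℕ) : ℝ) * (25 * (t / n)) ≤ K * (25 * (t / n)) := by gcongr
      _ = _ := by ring
  refine (measure_mono hsub).trans ((measure_union_le _ _).trans ?_)
  rw [ENNReal.ofReal_add (by positivity) (by positivity)]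
  refine add_le_add ?_ ?_
  · refine (measure_iUnion_le _).trans ?_
    rw [tsum_fintype]
    refine (Finset.sum_le_sum fun k _ => hone k).trans (le_of_eq ?_)
    rw [Finset.sum_const, Finset.card_univ, Fintype.card_fin, nsmul_eq_mul,
      ← ENNReal.ofReal_natCast, ← ENNReal.ofReal_mul (by positivity)]
    congr 1; ring
  · refine (measure_union_le _ _).trans ((add_le_add hchi hchi').trans (le_of_eq ?_))
    rw [← ENNReal.ofReal_add (by positivity) (by positivity)]
    congr 1
    rw [show t - 5 * t = -(4 * t) by ring]; ring

end OptimalScoring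

namespace OptimalScoring

/-! ### The bound `τ` -/

section

variable {p K : ℕ} {M : Model p K}

lemma Model.tau_nonneg (M : Model p K) : 0 ≤ M.tau :=
  Real.iSup_nonneg fun _ => Real.sqrt_nonneg _

lemma Model.variance_add_mean_sq_le (hS : M.covW.PosSemidef) (k : Fin K) (j : Fin p) :
    M.covW j j + M.mean k j ^ 2 ≤ M.tau ^ 2 := by
  have h1 : M.mean k j ^ 2 ≤ ⨆ k : Fin K, M.mean k j ^ 2 :=
    le_ciSup (f := fun k : Fin K => M.mean k j ^ 2) (Set.finite_range _).bddAbove k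
  have h2 : √(M.covW j j + ⨆ k : Fin K, M.mean k j ^ 2) ≤ M.tau :=
    le_ciSup (f := fun j : Fin p => √(M.covW j j + ⨆ k : Fin K, M.mean k j ^ 2))
      (Set.finite_range _).bddAbove j
  have h3 : 0 ≤ M.covW j j := hS.diag_nonneg
  have h4 := (Real.sqrt_le_left M.tau_nonneg).1 h2
  linarith

lemma Model.variance_le (hS : M.covW.PosSemidef) (hK : 2 ≤ K) (j : Fin p) :
    M.covW j j ≤ M.tau ^ 2 := by
  have := variance_add_mean_sq_le hS ⟨0, by omega⟩ j
  linarith [sq_nonneg (M.mean ⟨0, by omega⟩ j)]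

lemma Model.mean_sq_le (hS : M.covW.PosSemidef) (k : Fin K) (j : Fin p) :
    M.mean k j ^ 2 ≤ M.tau ^ 2 := by
  have := variance_add_mean_sq_le hS k j
  have h3 : 0 ≤ M.covW j j := hS.diag_nonneg
  linarith

lemma Model.abs_mean_le (hS : M.covW.PosSemidef) (k : Fin K) (j : Fin p) :
    |M.mean k j| ≤ M.tau :=
  abs_le_of_sq_le_sq (mean_sq_le hS k j) M.tau_nonneg

lemma Model.tau_pos (hS : M.covW.PosSemidef) (hK : 2 ≤ K) (hp : 1 ≤ p)
    {covT : Matrix (Fin p) (Fin p) ℝ}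
    (hT : ∀ a b, covT a b = M.covW a b + ∑ k, M.prior k * (M.mean k a * M.mean k b))
    (hdet : IsUnit covT.det) : 0 < M.tau := by
  refine M.tau_nonneg.lt_of_ne fun h0 => ?_
  have hm : ∀ k j, M.mean k j = 0 := fun k j => by
    have := mean_sq_le hS k j
    rw [← h0] at this
    nlinarith
  have hW : M.covW = 0 := by
    rw [← hS.trace_eq_zero_iff, Matrix.trace]
    refine Finset.sum_eq_zero fun j _ => le_antisymm ?_ hS.diag_nonneg
    have := variance_le hS hK j
    rw [← h0] at this
    simpa using this
  have : covT = 0 := by ext a b; simp [hT, hm, hW]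
  have : Nonempty (Fin p) := ⟨⟨0, hp⟩⟩
  simp_all

end

/-! ### The noise given the labels -/

/-- The contribution of an observation `y` of class `k` to the `(j, r)` entry of `Xᵀ E`, minus its
mean given the class; `α` is the deviation of the response from the mean fitted value. -/
noncomputable def Model.noiseTerm {p K : ℕ} (M : Model p K) (covT : Matrix (Fin p) (Fin p) ℝ)
    (j : Fin p) (r : Fin (K - 1)) (α : ℝ) (k : Fin K) (y : EuclideanSpace ℝ (Fin p)) : ℝ :=
  α * (y j - M.mean k j) - M.mean k j * (∑ a, M.coef covT a r * (y a - M.mean k a))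
    - ((y j - M.mean k j) * (∑ a, M.coef covT a r * (y a - M.mean k a))
      - ∑ a, M.covW j a * M.coef covT a r)

/-- The `(j, r)` entry of `Xᵀ E / n`, minus its mean given the labels `κ`. -/
noncomputable def Model.noise {n p K : ℕ} (M : Model p K) (covT : Matrix (Fin p) (Fin p) ℝ)
    (j : Fin p) (r : Fin (K - 1)) (κ : Fin n → Fin K) (y : Fin n → EuclideanSpace ℝ (Fin p)) : ℝ :=
  (∑ i, M.noiseTerm covT j r (scoreMatrix κ (κ i) r - M.fittedMean covT (κ i) r) (κ i) (y i)) / n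

section

variable {n p K : ℕ} {M : Model p K} {covT : Matrix (Fin p) (Fin p) ℝ}

lemma Model.measurable_noiseTerm (j : Fin p) (r : Fin (K - 1)) (α : ℝ) (k : Fin K) :
    Measurable (M.noiseTerm covT j r α k) := by
  unfold noiseTerm; fun_prop

open Matrix in
lemma Model.lintegral_exp_noiseTerm_le (hπ : ∀ k, 0 < M.prior k) (hS : M.covW.PosSemidef)
    (hK : 2 ≤ K) (hT : ∀ a b, covT a b = M.covW a b + ∑ k, M.prior k * (M.mean k a * M.mean k b))
    (hdet : IsUnit covT.det) (hτ : 0 < M.tau) (j : Fin p) (r : Fin (K - 1)) (α : ℝ) (k : Fin K)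
    {u : ℝ} (hu : |u| * M.tau ≤ 1 / 16) :
    ∫⁻ y, ENNReal.ofReal (Real.exp (u * M.noiseTerm covT j r α k y))
        ∂multivariateGaussian (M.mean k) M.covW
      ≤ ENNReal.ofReal (Real.exp ((u * M.tau) ^ 2 * (8 * α ^ 2 + 64))) := by
  have hβ := (M.fitted_variance_le hπ hS hT hdet (Pi.single r 1)).2
  have hcol : M.coef covT *ᵥ Pi.single r 1 = fun a => M.coef covT a r := by
    ext a; simp
  rw [hcol] at hβ
  have h1 : ∑ s, (Pi.single r 1 : Fin (K - 1) → ℝ) s ^ 2 = 1 := by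
    simp [Pi.single_apply]
  rw [h1] at hβ
  have := lintegral_exp_observation_le hS (M.mean k) (Pi.single j 1) (fun a => M.coef covT a r)
    (α := α) (m := M.mean k j) hτ (by simpa using variance_le hS hK j) hβ (mean_sq_le hS k j) hu
  refine le_trans (le_of_eq ?_) this
  refine lintegral_congr fun y => ?_
  congr 3
  simp [noiseTerm, Pi.single_apply, mulVec, dotProduct]

lemma sum_scoreMatrix_sq {κ : Fin n → Fin K} (hn : 0 < n) (hκ : ∀ k, 0 < freq κ k)
    (r : Fin (K - 1)) : ∑ i, scoreMatrix κ (κ i) r ^ 2 = n := by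
  have hn' : (0 : ℝ) < n := by exact_mod_cast hn
  have h := sum_freq_mul κ fun k => scoreMatrix κ k r ^ 2
  rw [eq_div_iff hn'.ne'] at h
  rw [← h, scoreMatrix_eq_helmert hn]
  have h1 := sum_weight_mul_helmert_sq hκ r
  simp_rw [sq, ← mul_assoc, h1, one_mul]

lemma freq_pos_of_mem {w : Fin K → ℝ} (hw : ∀ k, 0 < w k) {t : ℝ} {κ : Fin n → Fin K}
    (hκ : κ ∈ goodLabels n w t) (k : Fin K) : 0 < freq κ k := by
  have := (abs_le.1 (hκ.1 k)).1
  linarith [hw k]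

lemma Model.sum_deviation_sq_le (hn : 0 < n) (hπ : ∀ k, 0 < M.prior k) (hS : M.covW.PosSemidef)
    (hT : ∀ a b, covT a b = M.covW a b + ∑ k, M.prior k * (M.mean k a * M.mean k b))
    (hdet : IsUnit covT.det) {t : ℝ} {κ : Fin n → Fin K} (hκ : κ ∈ goodLabels n M.prior t)
    (r : Fin (K - 1)) :
    ∑ i, (scoreMatrix κ (κ i) r - M.fittedMean covT (κ i) r) ^ 2 ≤ 5 * n := by
  have hn' : (0 : ℝ) < n := by exact_mod_cast hn
  have h1 := sum_scoreMatrix_sq hn (freq_pos_of_mem hπ hκ) r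
  have h2 : ∑ i, M.fittedMean covT (κ i) r ^ 2 ≤ 3 / 2 * n := by
    have h := sum_freq_mul κ fun k => M.fittedMean covT k r ^ 2
    rw [eq_div_iff hn'.ne'] at h
    rw [← h]
    gcongr
    have hβ := (M.fitted_variance_le hπ hS hT hdet (Pi.single r 1)).1
    simp only [Pi.single_apply, mul_ite, mul_one, mul_zero, Finset.sum_ite_eq', Finset.mem_univ,
      if_true, ite_pow, one_pow, ne_eq, OfNat.ofNat_ne_zero, not_false_eq_true, zero_pow] at hβ
    calc ∑ k, freq κ k * M.fittedMean covT k r ^ 2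
        ≤ ∑ k, 3 / 2 * (M.prior k * M.fittedMean covT k r ^ 2) := by
          refine Finset.sum_le_sum fun k _ => ?_
          rw [← mul_assoc]
          gcongr
          have := (abs_le.1 (hκ.1 k)).2
          linarith
      _ ≤ 3 / 2 := by rw [← Finset.mul_sum]; linarith
  calc ∑ i, (scoreMatrix κ (κ i) r - M.fittedMean covT (κ i) r) ^ 2
      ≤ ∑ i, (2 * scoreMatrix κ (κ i) r ^ 2 + 2 * M.fittedMean covT (κ i) r ^ 2) := by
        refine Finset.sum_le_sum fun i _ => ?_
        nlinarith [sq_nonneg (scoreMatrix κ (κ i) r + M.fittedMean covT (κ i) r)]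
    _ ≤ 5 * (n : ℝ) := by
        rw [Finset.sum_add_distrib, ← Finset.mul_sum, ← Finset.mul_sum, h1]; linarith

end

section

variable {Ω : Type*} [MeasurableSpace Ω] {n p K : ℕ} {P : Measure Ω} {M : Model p K}
  {c : Fin n → Ω → Fin K} {x : Fin n → Ω → EuclideanSpace ℝ (Fin p)}
  {covT : Matrix (Fin p) (Fin p) ℝ}

lemma IsSample.measurable_noise (h : IsSample P M c x) (j : Fin p) (r : Fin (K - 1)) :
    Measurable fun ω => M.noise covT j r (fun i => c i ω) fun i => x i ω := by
  unfold Model.noise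
  refine Measurable.div_const (Finset.measurable_sum _ fun i _ => ?_) _
  have hF : Measurable fun z : (Fin n → Fin K) × EuclideanSpace ℝ (Fin p) => M.noiseTerm covT j r
      (scoreMatrix z.1 (z.1 i) r - M.fittedMean covT (z.1 i) r) (z.1 i) z.2 :=
    measurable_from_prod_countable_right fun κ =>
      Model.measurable_noiseTerm (M := M) (covT := covT) j r
        (scoreMatrix κ (κ i) r - M.fittedMean covT (κ i) r) (κ i)
  exact Measurable.comp (f := fun ω => ((fun i => c i ω : Fin n → Fin K), x i ω)) hF
    ((measurable_pi_lambda _ h.measurable_label).prodMk (h.measurable_feature i))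

variable [IsProbabilityMeasure P]

lemma IsSample.setLIntegral_exp_noise_le (h : IsSample P M c x) (hn : 0 < n) (hK : 2 ≤ K)
    (hπ : ∀ k, 0 < M.prior k) (hS : M.covW.PosSemidef)
    (hT : ∀ a b, covT a b = M.covW a b + ∑ k, M.prior k * (M.mean k a * M.mean k b))
    (hdet : IsUnit covT.det) (hτ : 0 < M.tau) (j : Fin p) (r : Fin (K - 1)) (t₀ : ℝ)
    {s : ℝ} (hs : |s / n| * M.tau ≤ 1 / 16) :
    ∫⁻ ω in {ω | (fun i => c i ω) ∈ goodLabels n M.prior t₀},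
        ENNReal.ofReal (Real.exp (s * M.noise covT j r (fun i => c i ω) fun i => x i ω)) ∂P
      ≤ ENNReal.ofReal (Real.exp ((s * M.tau) ^ 2 / n * 104)) := by
  have hn' : (0 : ℝ) < n := by exact_mod_cast hn
  set φ : (Fin n → Fin K) → Fin n → EuclideanSpace ℝ (Fin p) → ENNReal := fun κ i y =>
    ENNReal.ofReal (Real.exp (s / n * M.noiseTerm covT j r
      (scoreMatrix κ (κ i) r - M.fittedMean covT (κ i) r) (κ i) y)) with hφ
  have hprod : ∀ ω, ENNReal.ofReal (Real.exp (s * M.noise covT j r (fun i => c i ω)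
      fun i => x i ω)) = ∏ i, φ (fun i => c i ω) i (x i ω) := by
    intro ω
    rw [hφ, ← ENNReal.ofReal_prod_of_nonneg (fun _ _ => Real.exp_nonneg _), ← Real.exp_sum,
      ← Finset.mul_sum, Model.noise]
    congr 2; ring
  simp_rw [hprod]
  refine h.setLIntegral_prod_le hn hπ _ (fun κ i => ?_) fun κ hκ => ?_
  · exact (Real.measurable_exp.comp ((Model.measurable_noiseTerm j r _ _).const_mul _)).ennreal_ofReal
  · calc _ ≤ ∏ i, ENNReal.ofReal (Real.exp ((s / n * M.tau) ^ 2 *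
          (8 * (scoreMatrix κ (κ i) r - M.fittedMean covT (κ i) r) ^ 2 + 64))) :=
          Finset.prod_le_prod' fun i _ =>
            Model.lintegral_exp_noiseTerm_le hπ hS hK hT hdet hτ j r _ _ hs
      _ ≤ _ := by
        rw [← ENNReal.ofReal_prod_of_nonneg (fun _ _ => Real.exp_nonneg _), ← Real.exp_sum,
          ← Finset.mul_sum, Finset.sum_add_distrib, ← Finset.mul_sum]
        apply ENNReal.ofReal_le_ofReal
        apply Real.exp_le_exp.2
        have := Model.sum_deviation_sq_le hn hπ hS hT hdet hκ r
        calc _ ≤ (s / n * M.tau) ^ 2 * (104 * n) := by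
              gcongr
              simp only [Finset.sum_const, Finset.card_univ, Fintype.card_fin, nsmul_eq_mul]
              linarith
          _ = _ := by field_simp

lemma IsSample.measure_noise_ge_le (h : IsSample P M c x) (hn : 0 < n) (hK : 2 ≤ K)
    (hπ : ∀ k, 0 < M.prior k) (hS : M.covW.PosSemidef)
    (hT : ∀ a b, covT a b = M.covW a b + ∑ k, M.prior k * (M.mean k a * M.mean k b))
    (hdet : IsUnit covT.det) (hτ : 0 < M.tau) (j : Fin p) (t₀ : ℝ) {t : ℝ} (ht : 0 ≤ t)
    (htn : 256 * t ≤ n) :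
    P ({ω | (fun i => c i ω) ∈ goodLabels n M.prior t₀} ∩
      {ω | ((K - 1 : ℕ) : ℝ) * (112 * M.tau * √(t / n)) ^ 2 ≤
        ∑ r, M.noise covT j r (fun i => c i ω) (fun i => x i ω) ^ 2})
      ≤ ENNReal.ofReal (2 * Real.exp (-(8 * t))) := by
  have hn' : (0 : ℝ) < n := by exact_mod_cast hn
  have : Nonempty (Fin (K - 1)) := ⟨⟨0, by omega⟩⟩
  -- the exponential moment at `s` is `exp (104 t)`, and `s θ = 112 t` leaves `exp (-8 t)`
  set s := √(n * t) / M.tau with hs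
  have hs0 : 0 ≤ s := by positivity
  have hsτ : s * M.tau = √(n * t) := by rw [hs]; field_simp
  have hs1 : |s / n| * M.tau ≤ 1 / 16 := by
    rw [abs_of_nonneg (by positivity), div_mul_eq_mul_div, hsτ, div_le_iff₀ hn']
    refine Real.sqrt_le_iff.2 ⟨by positivity, ?_⟩
    nlinarith
  have hsq : (s * M.tau) ^ 2 / n = t := by
    rw [hsτ, Real.sq_sqrt (by positivity)]; field_simp
  have hsθ : s * (112 * M.tau * √(t / n)) = 112 * t := by
    rw [show s * (112 * M.tau * √(t / n)) = 112 * ((s * M.tau) * √(t / n)) by ring, hsτ,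
      ← Real.sqrt_mul (by positivity), show n * t * (t / n) = t ^ 2 by field_simp, Real.sqrt_sq ht]
  have hA : MeasurableSet {ω | (fun i => c i ω) ∈ goodLabels n M.prior t₀} :=
    (measurable_pi_lambda _ h.measurable_label) (Set.toFinite _).measurableSet
  have key := measure_inter_rms_ge_le (P := P) (s := s) (θ := 112 * M.tau * √(t / n))
    (v := fun r ω => M.noise covT j r (fun i => c i ω) fun i => x i ω)
    (fun r => h.measurable_noise j r) hA
    (fun r => h.setLIntegral_exp_noise_le hn hK hπ hS hT hdet hτ j r t₀ hs1)
    (fun r => by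
      have := h.setLIntegral_exp_noise_le hn hK hπ hS hT hdet hτ j r t₀ (s := -s)
        (by rw [neg_div, abs_neg]; exact hs1)
      rwa [neg_mul s M.tau, neg_sq] at this)
  rw [Fintype.card_fin] at key
  refine key.trans (le_of_eq ?_)
  rw [hsq, hsθ, ← ENNReal.ofReal_mul (by positivity), mul_assoc, ← Real.exp_add]
  congr 3; ring

end

end OptimalScoring

namespace OptimalScoring

/-! ### Decomposition of `Xᵀ E` -/

section

variable {n p K : ℕ} {M : Model p K} {covT : Matrix (Fin p) (Fin p) ℝ}

lemma response_apply (κ : Fin n → Fin K) (i : Fin n) (r : Fin (K - 1)) :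
    response κ i r = scoreMatrix κ (κ i) r := by
  simp [response, Matrix.mul_apply, indicatorMatrix]

/-- `Xᵀ E / n` is the noise plus a term that depends on the labels only and vanishes when the class
frequencies equal the class probabilities. -/
lemma transpose_mul_residual_apply (hn : 0 < n) (hπ : ∀ k, 0 < M.prior k)
    (hT : ∀ a b, covT a b = M.covW a b + ∑ k, M.prior k * (M.mean k a * M.mean k b))
    (hdet : IsUnit covT.det) (κ : Fin n → Fin K) (y : Fin n → EuclideanSpace ℝ (Fin p))
    (j : Fin p) (r : Fin (K - 1)) :
    ((dataMatrix y).transpose * residual M covT κ y) j r / n =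
      ∑ k, (freq κ k - M.prior k) * M.mean k j * helmert M.prior k r
      + (∑ k, freq κ k * M.mean k j * helmert (freq κ) k r
          - ∑ k, freq κ k * M.mean k j * helmert M.prior k r)
      - ∑ k, (freq κ k - M.prior k) * M.mean k j * M.fittedMean covT k r
      + M.noise covT j r κ y := by
  have hn' : (n : ℝ) ≠ 0 := by positivity
  have hC := M.contrast_eq hT hdet j r
  rw [M.contrast_apply hπ] at hC
  set ρ := ∑ a, M.covW j a * M.coef covT a r with hρ
  have hterm : ∀ i, y i j * residual M covT κ y i r =
      M.noiseTerm covT j r (scoreMatrix κ (κ i) r - M.fittedMean covT (κ i) r) (κ i) (y i) - ρ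
        + M.mean (κ i) j * (scoreMatrix κ (κ i) r - M.fittedMean covT (κ i) r) := by
    intro i
    have hx : (dataMatrix y * M.coef covT) i r = M.fittedMean covT (κ i) r
        + ∑ a, M.coef covT a r * (y i a - M.mean (κ i) a) := by
      rw [Matrix.mul_apply, Model.fittedMean, ← Finset.sum_add_distrib]
      refine Finset.sum_congr rfl fun a _ => ?_
      simp only [dataMatrix, Matrix.of_apply]; ring
    rw [residual, Matrix.sub_apply, response_apply, hx, Model.noiseTerm, ← hρ]
    ring
  have hsum : ((dataMatrix y).transpose * residual M covT κ y) j r / n =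
      M.noise covT j r κ y - ρ + ∑ k, freq κ k *
        (M.mean k j * (scoreMatrix κ k r - M.fittedMean covT k r)) := by
    rw [sum_freq_mul, Matrix.mul_apply]
    simp only [Matrix.transpose_apply, dataMatrix, Matrix.of_apply]
    simp_rw [show ∀ i, y i j * residual M covT κ y i r = _ from hterm]
    rw [Finset.sum_add_distrib, Finset.sum_sub_distrib, Model.noise]
    simp only [Finset.sum_const, Finset.card_univ, Fintype.card_fin, nsmul_eq_mul]
    field_simp
  rw [hsum, scoreMatrix_eq_helmert hn]
  simp only [sub_mul, mul_sub, Finset.sum_sub_distrib, ← mul_assoc]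
  linarith

lemma sum_nextClass_le {g : Fin K → ℝ} (hg : ∀ k, 0 ≤ g k) :
    ∑ r : Fin (K - 1), g (nextClass r) ≤ ∑ k, g k := by
  have hinj : Function.Injective (nextClass (K := K)) := by
    intro a b hab
    simp only [nextClass, Fin.mk.injEq] at hab
    exact Fin.ext (by omega)
  calc _ = ∑ k ∈ Finset.univ.map ⟨nextClass, hinj⟩, g k := by rw [Finset.sum_map]; rfl
    _ ≤ _ := Finset.sum_le_sum_of_subset_of_nonneg (Finset.subset_univ _) fun k _ _ => hg k

/-- The effect of replacing the population scores by the sample scores, in one entry. -/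
lemma abs_sum_helmert_sub_le {w f m : Fin K → ℝ} (hw : ∀ k, 0 < w k) (hf : ∀ k, w k / 2 ≤ f k)
    {τ : ℝ} (hm : ∀ k, |m k| ≤ τ) (r : Fin (K - 1)) :
    |∑ k, f k * m k * helmert f k r - ∑ k, f k * m k * helmert w k r| ≤
      5 * τ * (|f (nextClass r) - w (nextClass r)| / √(w (nextClass r))
        + |partialSum f (r.val + 1) - partialSum w (r.val + 1)| / √(partialSum w (r.val + 1))) := by
  have hf0 : ∀ k, 0 < f k := fun k => (half_pos (hw k)).trans_le (hf k)
  have hτ : 0 ≤ τ := (abs_nonneg _).trans (hm (nextClass r))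
  have hb := partialSum_pos hw r
  have hb' : partialSum w (r.val + 1) / 2 ≤ partialSum f (r.val + 1) := by
    have := partialSum_mono (w := fun k => (1 / 2 : ℝ) * w k) (w' := f)
      (fun k => by linarith [hf k]) (r.val + 1)
    rw [partialSum_const_mul] at this
    linarith
  have hS : |partialSum (fun k => f k * m k) (r.val + 1)| ≤ partialSum f (r.val + 1) * τ := by
    rw [partialSum, partialSum, Finset.sum_mul]
    refine (Finset.abs_sum_le_sum_abs _ _).trans (Finset.sum_le_sum fun k _ => ?_)
    rw [abs_mul, abs_of_pos (hf0 k)]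
    exact mul_le_mul_of_nonneg_left (hm k) (hf0 k).le
  have h1 := mul_abs_sqrt_sub_sqrt_le (hw (nextClass r)) hb (hf (nextClass r)) hb'
  have h2 := mul_abs_sqrt_sub_sqrt_le hb (hw (nextClass r)) hb' (hf (nextClass r))
  have hmr := hm (nextClass r)
  have hfr := hf0 (nextClass r)
  rw [sum_mul_helmert, sum_mul_helmert]
  rw [add_comm (f _) (partialSum _ _), add_comm (w _) (partialSum _ _)] at h2
  set a := w (nextClass r)
  set a' := f (nextClass r)
  set b := partialSum w (r.val + 1)
  set b' := partialSum f (r.val + 1)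
  set S := partialSum (fun k => f k * m k) (r.val + 1)
  set A' := √(a' / (b' * (b' + a')))
  set A := √(a / (b * (b + a)))
  set B' := √(b' / (a' * (b' + a')))
  set B := √(b / (a * (b + a)))
  set Da := |a' - a| / √a
  set Db := |b' - b| / √b
  calc |A' * S - B' * (a' * m (nextClass r)) - (A * S - B * (a' * m (nextClass r)))|
      = |(A' - A) * S - (B' - B) * (a' * m (nextClass r))| := by congr 1; ring
    _ ≤ |A' - A| * |S| + |B' - B| * (a' * |m (nextClass r)|) := by
        refine (abs_sub _ _).trans (le_of_eq ?_)
        rw [abs_mul, abs_mul, abs_mul a', abs_of_pos hfr]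
    _ ≤ |A' - A| * (b' * τ) + |B' - B| * (a' * τ) := by gcongr
    _ = τ * (b' * |A' - A|) + τ * (a' * |B' - B|) := by ring
    _ ≤ τ * (3 * Db + 2 * Da) + τ * (3 * Da + 2 * Db) := by gcongr
    _ = _ := by ring

/-- The effect of the fluctuation of the frequencies on a row, for any contraction `A`; it is used for
the population scores and for the class means of the fitted values. -/
lemma sum_sq_label_le (hw : ∀ k, 0 < M.prior k) (hS : M.covW.PosSemidef) {t : ℝ}
    {κ : Fin n → Fin K} (hκ : κ ∈ goodLabels n M.prior t) (j : Fin p)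
    {A : Fin K → Fin (K - 1) → ℝ}
    (hA : ∀ f : Fin (K - 1) → ℝ, ∑ k, M.prior k * (∑ r, A k r * f r) ^ 2 ≤ ∑ r, f r ^ 2) :
    ∑ r, (∑ k, (freq κ k - M.prior k) * M.mean k j * A k r) ^ 2
      ≤ M.tau ^ 2 * (25 * K * t / n) := by
  refine (sum_sq_dual_le hw hA _).trans ?_
  calc _ ≤ ∑ k, M.tau ^ 2 * ((freq κ k - M.prior k) ^ 2 / M.prior k) := by
        refine Finset.sum_le_sum fun k _ => ?_
        rw [mul_pow, mul_comm, mul_div_assoc]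
        exact mul_le_mul_of_nonneg_right (Model.mean_sq_le hS k j)
          (div_nonneg (sq_nonneg _) (hw k).le)
    _ ≤ _ := by
        rw [← Finset.mul_sum]
        gcongr
        exact hκ.2.1

/-- The effect of replacing the population scores by the sample scores, in a row. -/
lemma sum_sq_score_perturbation_le (hw : ∀ k, 0 < M.prior k) (hS : M.covW.PosSemidef) {t : ℝ}
    {κ : Fin n → Fin K} (hκ : κ ∈ goodLabels n M.prior t) (j : Fin p) :
    ∑ r, (∑ k, freq κ k * M.mean k j * helmert (freq κ) k r
          - ∑ k, freq κ k * M.mean k j * helmert M.prior k r) ^ 2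
      ≤ M.tau ^ 2 * (2500 * K * t / n) := by
  have hf : ∀ k, M.prior k / 2 ≤ freq κ k := fun k => by
    have := (abs_le.1 (hκ.1 k)).1
    linarith
  calc _ ≤ ∑ r : Fin (K - 1), 50 * M.tau ^ 2 *
        ((freq κ (nextClass r) - M.prior (nextClass r)) ^ 2 / M.prior (nextClass r)
          + (partialSum (freq κ) (r.val + 1) - partialSum M.prior (r.val + 1)) ^ 2
            / partialSum M.prior (r.val + 1)) := by
        refine Finset.sum_le_sum fun r _ => ?_
        have h1 := abs_sum_helmert_sub_le (m := fun k => M.mean k j) hw hf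
          (fun k => Model.abs_mean_le hS k j) r
        have ha := hw (nextClass r)
        have hb := partialSum_pos hw r
        refine (sq_le_sq' (neg_le_of_abs_le h1) (le_of_abs_le h1)).trans ?_
        rw [mul_pow, mul_pow]
        have e1 : (freq κ (nextClass r) - M.prior (nextClass r)) ^ 2 / M.prior (nextClass r)
            = (|freq κ (nextClass r) - M.prior (nextClass r)| / √(M.prior (nextClass r))) ^ 2 := by
          rw [div_pow, sq_abs, Real.sq_sqrt ha.le]
        have e2 : (partialSum (freq κ) (r.val + 1) - partialSum M.prior (r.val + 1)) ^ 2
              / partialSum M.prior (r.val + 1)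
            = (|partialSum (freq κ) (r.val + 1) - partialSum M.prior (r.val + 1)|
              / √(partialSum M.prior (r.val + 1))) ^ 2 := by
          rw [div_pow, sq_abs, Real.sq_sqrt hb.le]
        rw [e1, e2]
        generalize |freq κ (nextClass r) - M.prior (nextClass r)| / √(M.prior (nextClass r)) = u
        generalize |partialSum (freq κ) (r.val + 1) - partialSum M.prior (r.val + 1)|
              / √(partialSum M.prior (r.val + 1)) = v
        nlinarith [mul_nonneg (sq_nonneg M.tau) (sq_nonneg (u - v))]
    _ ≤ 50 * M.tau ^ 2 * (25 * K * t / n + 25 * K * t / n) := by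
        rw [← Finset.mul_sum, Finset.sum_add_distrib]
        gcongr
        · refine le_trans ?_ hκ.2.1
          exact sum_nextClass_le (g := fun k => (freq κ k - M.prior k) ^ 2 / M.prior k)
            fun k => div_nonneg (sq_nonneg _) (hw k).le
        · exact hκ.2.2
    _ = _ := by ring

/-- A bound for the rows of `Xᵀ E / n` when the labels are typical and the noise is small. -/
lemma sum_sq_row_le (hn : 0 < n) (hK : 2 ≤ K) (hπ : ∀ k, 0 < M.prior k)
    (hS : M.covW.PosSemidef)
    (hT : ∀ a b, covT a b = M.covW a b + ∑ k, M.prior k * (M.mean k a * M.mean k b))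
    (hdet : IsUnit covT.det) {t₀ t : ℝ} (ht₀ : t₀ ≤ t) (ht : 0 ≤ t) {κ : Fin n → Fin K}
    (hκ : κ ∈ goodLabels n M.prior t₀) {y : Fin n → EuclideanSpace ℝ (Fin p)} {j : Fin p}
    (hy : ∑ r, M.noise covT j r κ y ^ 2
      ≤ ((K - 1 : ℕ) : ℝ) * (112 * M.tau * √(t / n)) ^ 2) :
    ∑ r, (((dataMatrix y).transpose * residual M covT κ y) j r / n) ^ 2
      ≤ 80000 * M.tau ^ 2 * (((K : ℝ) - 1) * t / n) := by
  have hn' : (0 : ℝ) < n := by exact_mod_cast hn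
  have h1 := sum_sq_label_le hπ hS hκ j fun f => (helmert_isometry hπ f).le
  have h2 := sum_sq_score_perturbation_le hπ hS hκ j
  have h3 := sum_sq_label_le hπ hS hκ j fun f => (M.fitted_variance_le hπ hS hT hdet f).1
  have hK1 : ((K - 1 : ℕ) : ℝ) = (K : ℝ) - 1 := by
    rw [Nat.cast_sub (by omega), Nat.cast_one]
  rw [hK1, mul_pow, mul_pow, Real.sq_sqrt (by positivity)] at hy
  simp_rw [transpose_mul_residual_apply hn hπ hT hdet κ y j]
  have h4 : ∀ a b c d : ℝ, (a + b - c + d) ^ 2 ≤ 4 * (a ^ 2 + b ^ 2 + c ^ 2 + d ^ 2) := by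
    intro a b c d
    nlinarith [sq_nonneg (a - b), sq_nonneg (a + c), sq_nonneg (a - d), sq_nonneg (b + c),
      sq_nonneg (b - d), sq_nonneg (c + d)]
  refine (Finset.sum_le_sum fun r _ => h4 _ _ _ _).trans ?_
  rw [← Finset.mul_sum, Finset.sum_add_distrib, Finset.sum_add_distrib, Finset.sum_add_distrib]
  have hK2 : (2 : ℝ) ≤ K := by exact_mod_cast hK
  have h5 : K * t₀ / n ≤ 2 * (((K : ℝ) - 1) * t / n) := by
    rw [← mul_div_assoc]
    refine div_le_div_of_nonneg_right ?_ hn'.le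
    nlinarith
  have h6 : M.tau ^ 2 * (K * t₀ / n) ≤ M.tau ^ 2 * (2 * (((K : ℝ) - 1) * t / n)) := by gcongr
  have e1 : M.tau ^ 2 * (25 * K * t₀ / n) = 25 * (M.tau ^ 2 * (K * t₀ / n)) := by ring
  have e2 : M.tau ^ 2 * (2500 * K * t₀ / n) = 2500 * (M.tau ^ 2 * (K * t₀ / n)) := by ring
  have e3 : ((K : ℝ) - 1) * (112 ^ 2 * M.tau ^ 2 * (t / n))
      = 12544 * (M.tau ^ 2 * (((K : ℝ) - 1) * t / n)) := by ring
  rw [e1] at h1 h3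
  rw [e2] at h2
  rw [e3] at hy
  have h7 : 0 ≤ M.tau ^ 2 * (((K : ℝ) - 1) * t / n) := by
    have : (0 : ℝ) ≤ (K : ℝ) - 1 := by linarith
    positivity
  linarith

lemma normInfTwo_le {a b : ℕ} {A : Matrix (Fin a) (Fin b) ℝ} {B : ℝ} (hB : 0 ≤ B)
    (h : ∀ i, ∑ j, A i j ^ 2 ≤ B ^ 2) : normInfTwo A ≤ B :=
  Real.iSup_le (fun i => Real.sqrt_le_iff.2 ⟨hB, h i⟩) hB

end

/-! ### The probability bound -/

/-- The finite-sample form of the bound. -/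
theorem IsSample.measureReal_normInfTwo_le {Ω : Type*} [MeasurableSpace Ω] {n p K : ℕ}
    {P : Measure Ω} [IsProbabilityMeasure P] {M : Model p K} {c : Fin n → Ω → Fin K}
    {x : Fin n → Ω → EuclideanSpace ℝ (Fin p)} {covT : Matrix (Fin p) (Fin p) ℝ}
    (h : IsSample P M c x) (hn : 0 < n) (hp : 1 ≤ p) (hK : 2 ≤ K) {η q₀ : ℝ} (hη0 : 0 < η)
    (hη1 : η < 1) (hpη : 2 ≤ p * η⁻¹) (hq₀ : 0 < q₀) (hπ : ∀ k, q₀ ≤ M.prior k)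
    (hS : M.covW.PosSemidef) (hμ : ∑ k, M.prior k • M.mean k = 0)
    (hcov : ∀ i, covMat P (x i) = covT) (hdet : IsUnit covT.det)
    (hKn : 16 * Real.log (8 * K * η⁻¹) ≤ n * q₀)
    (hpn : 256 * (Real.log (p * η⁻¹) + 1) ≤ n) :
    1 - η ≤ P.real {ω | (∀ k, 0 < classCount (fun i => c i ω) k) ∧
      1 / (n : ℝ) * normInfTwo ((dataMatrix fun i => x i ω).transpose *
        residual M covT (fun i => c i ω) (fun i => x i ω)) ≤
      500 * M.tau * √(((K : ℝ) - 1) * Real.log (p * η⁻¹) / n)} := by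
  have hn' : (0 : ℝ) < n := by exact_mod_cast hn
  have hπ0 : ∀ k, 0 < M.prior k := fun k => hq₀.trans_le (hπ k)
  have hT : ∀ a b, covT a b = M.covW a b + ∑ k, M.prior k * (M.mean k a * M.mean k b) := by
    intro a b
    rw [← hcov ⟨0, hn⟩, h.covMat_apply hπ0 hS hμ]
  have hτ := Model.tau_pos hS hK hp hT hdet
  have hη2 : 1 < η⁻¹ := (one_lt_inv₀ hη0).2 hη1
  have hK2 : (2 : ℝ) ≤ K := by exact_mod_cast hK
  have hp1 : (1 : ℝ) ≤ p := by exact_mod_cast hp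
  set L := Real.log (p * η⁻¹) with hL
  have hL2 : 1 / 2 ≤ L := by
    have : Real.log 2 ≤ L := Real.log_le_log (by norm_num) hpη
    linarith [Real.log_two_gt_d9]
  set t₀ := Real.log η⁻¹ + 1 with ht₀
  have hlogη : 0 < Real.log η⁻¹ := Real.log_pos hη2
  have ht₀t : t₀ ≤ L + 1 := by
    have : Real.log η⁻¹ ≤ L := Real.log_le_log (by positivity) (by nlinarith)
    linarith
  have ht₀n : t₀ ≤ n * q₀ := by
    have h1 : Real.log (8 * K * η⁻¹) = Real.log (8 * K) + Real.log η⁻¹ :=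
      Real.log_mul (by positivity) (by positivity)
    have h2 : Real.log 2 ≤ Real.log (8 * K) := Real.log_le_log (by norm_num) (by linarith)
    linarith [Real.log_two_gt_d9]
  -- the labels are atypical with probability at most `η/2`
  have hlab := h.measure_compl_goodLabels_le hn hK hq₀ hπ (by linarith) ht₀n
  have hb1 : 2 * K * Real.exp (-(n * q₀ / 16)) ≤ η / 4 := by
    have h1 : Real.exp (-(n * q₀ / 16)) ≤ (8 * K * η⁻¹)⁻¹ := by
      rw [← Real.exp_log (show 0 < (8 * K * η⁻¹)⁻¹ by positivity), Real.log_inv]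
      apply Real.exp_le_exp.2; linarith
    calc 2 * K * Real.exp (-(n * q₀ / 16)) ≤ 2 * K * (8 * K * η⁻¹)⁻¹ := by gcongr
      _ = η / 4 := by field_simp; norm_num
  have hexp4 : Real.exp (-4) ≤ 1 / 16 := by
    have h1 : Real.exp (-4) = (Real.exp 1 ^ 4)⁻¹ := by
      rw [Real.exp_neg, ← Real.exp_nat_mul]; norm_num
    rw [h1, inv_le_comm₀ (by positivity) (by norm_num)]
    have := Real.exp_one_gt_d9
    calc ((1 / 16 : ℝ))⁻¹ = 2 ^ 4 := by norm_num
      _ ≤ _ := by gcongr; linarith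
  have hb2 : 4 * Real.exp (-(4 * t₀)) ≤ η / 4 := by
    have h1 : Real.exp (-(4 * t₀)) ≤ Real.exp (-4) * η := by
      nth_rewrite 1 [← Real.exp_log hη0]
      rw [← Real.exp_add]
      apply Real.exp_le_exp.2
      rw [Real.log_inv] at hlogη ht₀
      linarith
    nlinarith
  -- the noise of some feature is large with probability at most `η/4`
  have hnoise := fun j => h.measure_noise_ge_le hn hK hπ0 hS hT hdet hτ j t₀ (t := L + 1)
    (by linarith) hpn
  have hb3 : p * (2 * Real.exp (-(8 * (L + 1)))) ≤ η / 4 := by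
    have h1 : Real.exp (-(8 * (L + 1))) ≤ Real.exp (-4) * (p * η⁻¹)⁻¹ := by
      rw [← Real.exp_log (show 0 < (p * η⁻¹)⁻¹ by positivity), ← Real.exp_add, Real.log_inv]
      apply Real.exp_le_exp.2
      linarith
    calc p * (2 * Real.exp (-(8 * (L + 1)))) ≤ p * (2 * (1 / 16 * (p * η⁻¹)⁻¹)) := by
          gcongr
          exact h1.trans (by gcongr)
      _ = η / 8 := by field_simp; norm_num
      _ ≤ η / 4 := by linarith
  set G := {ω | (∀ k, 0 < classCount (fun i => c i ω) k) ∧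
      1 / (n : ℝ) * normInfTwo ((dataMatrix fun i => x i ω).transpose *
        residual M covT (fun i => c i ω) (fun i => x i ω)) ≤
      500 * M.tau * √(((K : ℝ) - 1) * L / n)} with hG
  set B₁ := {ω | (fun i => c i ω) ∉ goodLabels n M.prior t₀} with hB₁
  set B₂ : Fin p → Set Ω := fun j => {ω | (fun i => c i ω) ∈ goodLabels n M.prior t₀} ∩
      {ω | ((K - 1 : ℕ) : ℝ) * (112 * M.tau * √((L + 1) / n)) ^ 2 ≤
        ∑ r, M.noise covT j r (fun i => c i ω) (fun i => x i ω) ^ 2} with hB₂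
  have hcover : Set.univ ⊆ G ∪ (B₁ ∪ ⋃ j, B₂ j) := by
    intro ω _
    by_contra hcon
    simp only [Set.mem_union, Set.mem_iUnion, not_or, not_exists] at hcon
    obtain ⟨hG', hB₁', hB₂'⟩ := hcon
    have hgood : (fun i => c i ω) ∈ goodLabels n M.prior t₀ := not_not.1 hB₁'
    refine hG' ⟨fun k => ?_, ?_⟩
    · have := freq_pos_of_mem hπ0 hgood k
      rw [freq, div_pos_iff_of_pos_right hn'] at this
      exact_mod_cast this
    · have hrow : ∀ j, ∑ r, (((dataMatrix fun i => x i ω).transpose *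
          residual M covT (fun i => c i ω) (fun i => x i ω)) j r) ^ 2 ≤
          (n * (500 * M.tau * √(((K : ℝ) - 1) * L / n))) ^ 2 := by
        intro j
        have hsmall : ∑ r, M.noise covT j r (fun i => c i ω) (fun i => x i ω) ^ 2
            ≤ ((K - 1 : ℕ) : ℝ) * (112 * M.tau * √((L + 1) / n)) ^ 2 :=
          le_of_not_ge fun hge => hB₂' j ⟨hgood, hge⟩
        have := sum_sq_row_le hn hK hπ0 hS hT hdet ht₀t (by linarith) hgood hsmall
        simp_rw [div_pow] at this
        rw [← Finset.sum_div, div_le_iff₀ (by positivity)] at this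
        refine this.trans ?_
        have hK1 : (0 : ℝ) ≤ (K : ℝ) - 1 := by linarith
        rw [mul_pow, mul_pow, mul_pow, Real.sq_sqrt (by positivity), mul_comm ((n : ℝ) ^ 2)]
        gcongr ?_ * _
        have h3 : ((K : ℝ) - 1) * (L + 1) / n ≤ 3 * (((K : ℝ) - 1) * L / n) := by
          rw [← mul_div_assoc]
          refine div_le_div_of_nonneg_right ?_ hn'.le
          nlinarith
        have h4 : 0 ≤ M.tau ^ 2 * (((K : ℝ) - 1) * L / n) := by positivity
        calc 80000 * M.tau ^ 2 * (((K : ℝ) - 1) * (L + 1) / n)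
            ≤ 80000 * M.tau ^ 2 * (3 * (((K : ℝ) - 1) * L / n)) := by gcongr
          _ ≤ 500 ^ 2 * M.tau ^ 2 * (((K : ℝ) - 1) * L / n) := by linarith
      have := normInfTwo_le (by positivity) hrow
      rw [one_div, inv_mul_le_iff₀ hn']
      exact this
  have htot : P (B₁ ∪ ⋃ j, B₂ j) ≤ ENNReal.ofReal η := by
    have hη : η / 4 + η / 4 + η / 4 ≤ η := by linarith
    refine (measure_union_le _ _).trans ?_
    refine (add_le_add (hlab.trans (ENNReal.ofReal_le_ofReal (add_le_add hb1 hb2)))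
      ((measure_iUnion_le _).trans ?_)).trans
      ((ENNReal.ofReal_add (by positivity) (by positivity)).symm.le.trans
        (ENNReal.ofReal_le_ofReal hη))
    rw [tsum_fintype]
    refine (Finset.sum_le_sum fun j _ => hnoise j).trans ?_
    rw [Finset.sum_const, Finset.card_univ, Fintype.card_fin, nsmul_eq_mul,
      ← ENNReal.ofReal_natCast, ← ENNReal.ofReal_mul (by positivity)]
    exact ENNReal.ofReal_le_ofReal hb3
  have hreal : P.real (B₁ ∪ ⋃ j, B₂ j) ≤ η := ENNReal.toReal_le_of_le_ofReal hη0.le htot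
  have h1 : P.real Set.univ ≤ P.real (G ∪ (B₁ ∪ ⋃ j, B₂ j)) := measureReal_mono hcover
  have h2 := measureReal_union_le (μ := P) G (B₁ ∪ ⋃ j, B₂ j)
  rw [probReal_univ] at h1
  linarith

end OptimalScoring

theorem theorem3 :
    ∃ C : ℝ, 0 < C ∧
      ∀ (η : ℝ), 0 < η → η < 1 →
      ∀ (p K : ℕ → ℕ) (πmin : ℕ → ℝ)
        (M : ∀ n, OptimalScoring.Model (p n) (K n))
        (covT : ∀ n, Matrix (Fin (p n)) (Fin (p n)) ℝ)
        (Ω : ℕ → Type*) [∀ n, MeasurableSpace (Ω n)]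
        (P : ∀ n, Measure (Ω n)) [∀ n, IsProbabilityMeasure (P n)]
        (c : ∀ n, Fin n → Ω n → Fin (K n))
        (x : ∀ n, Fin n → Ω n → EuclideanSpace ℝ (Fin (p n))),
      -- at least one feature and two classes; `p = 1` only together with `η ≤ 1/2`
      (∀ n, 1 ≤ p n ∧ (2 ≤ p n ∨ η ≤ 1 / 2)) →
      (∀ n, 2 ≤ K n) →
      -- class probabilities
      (∀ n, 0 < πmin n) →
      (∀ n k, πmin n ≤ (M n).prior k) →
      ((fun n => Real.log (K n)) =o[atTop] fun n => (n : ℝ) * πmin n) →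
      -- independent observations with Gaussian classes, overall mean zero
      (∀ n, (M n).covW.PosSemidef) →
      (∀ n, ∑ k, (M n).prior k • (M n).mean k = 0) →
      (∀ n, OptimalScoring.IsSample (P n) (M n) (c n) (x n)) →
      -- `covT n` is the marginal covariance matrix, and it is invertible
      (∀ n i, OptimalScoring.covMat (P n) (x n i) = covT n) →
      (∀ n, IsUnit (covT n).det) →
      -- sample size
      ((fun n => Real.log (p n)) =o[atTop] fun n => (n : ℝ)) →
      ∀ᶠ n in atTop,
        1 - η ≤ (P n).real {ω |
          (∀ k, 0 < OptimalScoring.classCount (fun i => c n i ω) k) ∧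
          1 / (n : ℝ) * OptimalScoring.normInfTwo
              ((OptimalScoring.dataMatrix fun i => x n i ω).transpose *
                OptimalScoring.residual (M n) (covT n) (fun i => c n i ω) (fun i => x n i ω)) ≤
            C * (M n).tau * √(((K n : ℝ) - 1) * Real.log ((p n : ℝ) * η⁻¹) / n)} := by
  refine ⟨500, by norm_num, ?_⟩
  intro η hη0 hη1 p K πmin M covT Ω _ P _ c x hpη hK hπ0 hπ hKo hS hμ hsample hcov hdet hpo
  have hη2 : 1 < η⁻¹ := (one_lt_inv₀ hη0).2 hη1
  have hlog8 : 0 < Real.log (8 * η⁻¹) := Real.log_pos (by linarith)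
  -- `log (8 K / η)` is at most a constant multiple of `log K`, as `K ≥ 2`
  set A := Real.log (8 * η⁻¹) / Real.log 2 + 1 with hA
  have hlog2 : 0 < Real.log 2 := Real.log_pos (by norm_num)
  have hA0 : 0 < A := by positivity
  have hKo' := hKo.bound (show (0 : ℝ) < 1 / (16 * A) by positivity)
  have hpo' := hpo.bound (show (0 : ℝ) < 1 / 512 by norm_num)
  have hn0 : ∀ᶠ n : ℕ in atTop, 512 * (Real.log η⁻¹ + 1) ≤ (n : ℝ) :=
    tendsto_natCast_atTop_atTop.eventually_ge_atTop _
  filter_upwards [hKo', hpo', hn0, eventually_gt_atTop 0] with n h1 h2 h3 hn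
  have hn' : (0 : ℝ) < n := by exact_mod_cast hn
  have hp1 : (1 : ℝ) ≤ p n := by exact_mod_cast (hpη n).1
  have hK2 : (2 : ℝ) ≤ K n := by exact_mod_cast hK n
  have hlogK : Real.log 2 ≤ Real.log (K n) := Real.log_le_log (by norm_num) hK2
  rw [Real.norm_of_nonneg (hlog2.le.trans hlogK),
    Real.norm_of_nonneg (mul_nonneg hn'.le (hπ0 n).le)] at h1
  rw [Real.norm_of_nonneg (Real.log_nonneg hp1), Real.norm_of_nonneg hn'.le] at h2
  refine (hsample n).measureReal_normInfTwo_le hn (hpη n).1 (hK n) hη0 hη1 ?_ (hπ0 n) (hπ n)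
    (hS n) (hμ n) (hcov n) (hdet n) ?_ ?_
  · rw [← div_eq_mul_inv, le_div_iff₀ hη0]
    rcases (hpη n).2 with h | h
    · have : (2 : ℝ) ≤ p n := by exact_mod_cast h
      linarith
    · linarith
  · have h4 : Real.log (8 * K n * η⁻¹) = Real.log (8 * η⁻¹) + Real.log (K n) := by
      rw [← Real.log_mul (by positivity) (by positivity)]; congr 1; ring
    have h5 : Real.log (8 * η⁻¹) ≤ Real.log (8 * η⁻¹) / Real.log 2 * Real.log (K n) := by
      rw [div_mul_eq_mul_div, le_div_iff₀ hlog2]; gcongr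
    have h6 : A * Real.log (K n) ≤ A * (1 / (16 * A) * (n * πmin n)) := by gcongr
    have h7 : A * (1 / (16 * A) * (n * πmin n)) = n * πmin n / 16 := by field_simp
    rw [h4]
    rw [hA] at h6 h7
    linarith
  · rw [Real.log_mul (by positivity) (by positivity)]
    linarith
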